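/- Let $d\ge 2$ and let $D\subset\mathbb R^d$ be a bounded domain with Lipschitz boundary $\partial D$, equipped with its surface measure. Let $H^{1/2}(\partial D)$ be the space of traces $u|_{\partial D}\in L^2(\partial D)$ of (complex-valued) functions $u\in H^1(D)$, with the norm $\|f\|_{H^{1/2}(\partial D)}=\inf\{\|u\|_{H^1(D)} : u|_{\partial D}=f\}$. For a conductivity $\gamma$, that is, a real bounded measurable function on $D$ with a positive lower bound, the Dirichlet problem $\nabla\cdot(\gamma\nabla u)=0$ in $D$, $u|_{\partial D}=f$, has a unique weak solution $u\in H^1(D)$ for every $f\in H^{1/2}(\partial D)$, and the Dirichlet-to-Neumann map $\Lambda_\gamma$ is well defined by $\int_{\partial D}\Lambda_\gamma f\,g=\int_D\gamma\,\nabla u\cdot\nabla v\,dx$ for $f,g\in H^{1/2}(\partial D)$, where $v\in H^1(D)$ is any function with $v|_{\partial D}=g$. Let $(\Omega,\mathcal H,\mathbb P)$ be a probability space and $\{X_\alpha:\alpha\in\mathbb N^2\}$ independent complex random variables (for instance Gaussian) with $\mathbb E X_\alpha=0$, $\mathbb E(X_\alpha\overline{X_\alpha})=1$ and $\mathbb E(X_\alpha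 X_\alpha)=0$ for all $\alpha\in\mathbb N^2$. Let $\{e_n:n\in\mathbb N\}$ be an orthonormal basis of $L^2(\partial D)$, let $(\phi|\psi)=\int_{\partial D}\phi\overline\psi$, and let $$\mathcal N_\gamma(f,g)=\int_{\partial D}\Lambda_\gamma f\,g+\sum_{\alpha=(\alpha_1,\alpha_2)\in\mathbb N^2}(f|e_{\alpha_1})(g|e_{\alpha_2})X_\alpha,\qquad f,g\in H^{1/2}(\partial D),$$ be the noisy data, the series being taken in $L^2(\Omega,\mathcal H,\mathbb P)$. Then the series converges unconditionally in $L^2(\Omega,\mathcal H,\mathbb P)$ for all $f,g\in H^{1/2}(\partial D)$, the map $\mathcal N_\gamma:H^{1/2}(\partial D)\times H^{1/2}(\partial D)\to L^2(\Omega,\mathcal H,\mathbb P)$ is bilinear, and it is bounded: there is a constant $C>0$ depending only on $d$ and $D$ (not on $\gamma$, the probability space, the $X_\alpha$, the basis, or $f,g$) such that $$\mathbb E\,|\mathcal N_\gamma(f,g)|^2\le C\,(1+\|\gamma\|_{L^\infty(D)}^2)\,\|f\|_{H^{1/2}(\partial D)}^2\,\|g\|_{H^{1/2}(\partial D)}^2\qquad\text{for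 all }f,g\in H^{1/2}(\partial D).$$ Moreover $\mathcal N_\gamma(f,g)$ is finite almost surely, in the following sense: for all $f,g\in H^{1/2}(\partial D)$ and every enumeration of $\mathbb N^2$, the partial sums of the series defining $\mathcal N_\gamma(f,g)$ converge almost surely, to the complex number $\mathcal N_\gamma(f,g)(\omega)$. -/

import Mathlib

open MeasureTheory ProbabilityTheory Filter Topology
open scoped ENNReal NNReal ComplexConjugate InnerProductSpace

noncomputable section

namespace Calderon

/-- Euclidean space `ℝ^d`. -/
abbrev Eu (d : ℕ) : Type := EuclideanSpace ℝ (Fin d)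

/-- A bounded domain of `ℝ^d` with Lipschitz boundary: near each boundary point, in suitable
Euclidean coordinates `(y', y_d)`, the set is the region above the graph of a Lipschitz function
`φ : ℝ^(d-1) → ℝ`, and its boundary is that graph. -/
structure IsBoundedLipschitzDomain {d : ℕ} (D : Set (Eu d)) : Prop where
  isOpen : IsOpen D
  isConnected : IsConnected D
  isBounded : Bornology.IsBounded D
  graph : ∀ P ∈ frontier D, ∃ (y : Eu d ≃ₗᵢ[ℝ] WithLp 2 (Eu (d - 1) × ℝ)) (ρ : ℝ)
      (φ : Eu (d - 1) → ℝ) (K : ℝ≥0), 0 < ρ ∧ LipschitzWith K φ ∧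
      Metric.ball P ρ ∩ D = Metric.ball P ρ ∩ {x | φ (y x).fst < (y x).snd} ∧
      Metric.ball P ρ ∩ frontier D = Metric.ball P ρ ∩ {x | (y x).snd = φ (y x).fst}

/-- The surface measure on `∂D`: the `(d-1)`-dimensional Hausdorff measure (normalised so as to
agree with Lebesgue measure on `ℝ^(d-1)`), restricted to `∂D`. -/
def surfaceMeasure {d : ℕ} (D : Set (Eu d)) : Measure (Eu d) :=
  (Measure.euclideanHausdorffMeasure (d - 1)).restrict (frontier D)

/-- `L²(D)`, complex valued. -/
abbrev L2Domain {d : ℕ} (D : Set (Eu d)) : Type :=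
  Lp ℂ 2 ((volume : Measure (Eu d)).restrict D)

/-- `L²(∂D)`, complex valued. -/
abbrev L2Boundary {d : ℕ} (D : Set (Eu d)) : Type :=
  Lp ℂ 2 (surfaceMeasure D)

/-- Pairs `(u, G)` with `u ∈ L²(D)`, `G ∈ L²(D)^d`, with the norm `(‖u‖² + ∑ ‖G_i‖²)^(1/2)`. -/
abbrev L2Jet {d : ℕ} (D : Set (Eu d)) : Type :=
  WithLp 2 (L2Domain D × PiLp 2 (fun _ : Fin d => L2Domain D))

/-- `φ ∈ C_c^∞(D)`, real valued. -/
structure IsTestFunction {d : ℕ} (D : Set (Eu d)) (φ : Eu d → ℝ) : Prop where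
  smooth : ContDiff ℝ (⊤ : ℕ∞) φ
  compact : HasCompactSupport φ
  supp : tsupport φ ⊆ D

/-- `g` is the weak partial derivative `∂_i u` in `D`. -/
def IsWeakPartial {d : ℕ} (D : Set (Eu d)) (i : Fin d) (u g : L2Domain D) : Prop :=
  ∀ φ : Eu d → ℝ, IsTestFunction D φ →
    ∫ x in D, fderiv ℝ φ x (EuclideanSpace.single i 1) • u x = - ∫ x in D, φ x • g x

theorem IsTestFunction.integrable_smul {d : ℕ} {D : Set (Eu d)} {φ : Eu d → ℝ}
    (hφ : IsTestFunction D φ) (u : L2Domain D) :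
    Integrable (fun x => φ x • u x) (volume.restrict D) := by
  have h1 : MemLp φ 2 ((volume : Measure (Eu d)).restrict D) :=
    (hφ.smooth.continuous.memLp_of_hasCompactSupport hφ.compact).restrict D
  exact memLp_one_iff_integrable.1 ((Lp.memLp u).smul h1)

theorem IsTestFunction.integrable_fderiv_smul {d : ℕ} {D : Set (Eu d)} {φ : Eu d → ℝ}
    (hφ : IsTestFunction D φ) (v : Eu d) (u : L2Domain D) :
    Integrable (fun x => fderiv ℝ φ x v • u x) (volume.restrict D) := by
  have hc : Continuous (fun x => fderiv ℝ φ x v) :=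
    (hφ.smooth.continuous_fderiv (by simp)).clm_apply continuous_const
  have hs : HasCompactSupport (fun x => fderiv ℝ φ x v) := hφ.compact.fderiv_apply ℝ v
  have h1 : MemLp (fun x => fderiv ℝ φ x v) 2 ((volume : Measure (Eu d)).restrict D) :=
    (hc.memLp_of_hasCompactSupport hs).restrict D
  exact memLp_one_iff_integrable.1 ((Lp.memLp u).smul h1)

theorem IsWeakPartial.zero {d : ℕ} {D : Set (Eu d)} {i : Fin d} :
    IsWeakPartial D i 0 0 := by
  intro φ _
  have h0 := Lp.coeFn_zero ℂ 2 ((volume : Measure (Eu d)).restrict D)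
  have h1 : ∫ x in D, fderiv ℝ φ x (EuclideanSpace.single i 1) • (0 : L2Domain D) x = 0 :=
    integral_eq_zero_of_ae (by filter_upwards [h0] with x hx; rw [hx, Pi.zero_apply, smul_zero])
  have h2 : ∫ x in D, φ x • (0 : L2Domain D) x = 0 :=
    integral_eq_zero_of_ae (by filter_upwards [h0] with x hx; rw [hx, Pi.zero_apply, smul_zero])
  rw [h1, h2, neg_zero]

theorem IsWeakPartial.add {d : ℕ} {D : Set (Eu d)} {i : Fin d} {u g u' g' : L2Domain D}
    (h : IsWeakPartial D i u g) (h' : IsWeakPartial D i u' g') :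
    IsWeakPartial D i (u + u') (g + g') := by
  intro φ hφ
  have e1 : ∫ x in D, fderiv ℝ φ x (EuclideanSpace.single i 1) • (u + u') x
      = ∫ x in D, (fderiv ℝ φ x (EuclideanSpace.single i 1) • u x
        + fderiv ℝ φ x (EuclideanSpace.single i 1) • u' x) :=
    integral_congr_ae (by
      filter_upwards [Lp.coeFn_add u u'] with x hx
      rw [hx, Pi.add_apply, smul_add])
  have e2 : ∫ x in D, φ x • (g + g') x = ∫ x in D, (φ x • g x + φ x • g' x) :=
    integral_congr_ae (by
      filter_upwards [Lp.coeFn_add g g'] with x hx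
      rw [hx, Pi.add_apply, smul_add])
  rw [e1, e2, integral_add (hφ.integrable_fderiv_smul _ u) (hφ.integrable_fderiv_smul _ u'),
    integral_add (hφ.integrable_smul g) (hφ.integrable_smul g'), h φ hφ, h' φ hφ, neg_add]

theorem IsWeakPartial.smul {d : ℕ} {D : Set (Eu d)} {i : Fin d} {u g : L2Domain D}
    (c : ℂ) (h : IsWeakPartial D i u g) : IsWeakPartial D i (c • u) (c • g) := by
  intro φ hφ
  have e1 : ∫ x in D, fderiv ℝ φ x (EuclideanSpace.single i 1) • (c • u) x
      = ∫ x in D, c • (fderiv ℝ φ x (EuclideanSpace.single i 1) • u x) :=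
    integral_congr_ae (by
      filter_upwards [Lp.coeFn_smul c u] with x hx
      rw [hx, Pi.smul_apply, smul_comm])
  have e2 : ∫ x in D, φ x • (c • g) x = ∫ x in D, c • (φ x • g x) :=
    integral_congr_ae (by
      filter_upwards [Lp.coeFn_smul c g] with x hx
      rw [hx, Pi.smul_apply, smul_comm])
  rw [e1, e2, integral_smul, integral_smul, h φ hφ, smul_neg]

/-- The Sobolev space `H¹(D)`: pairs `(u, ∇u)` of a function in `L²(D)` and its weak gradient in
`L²(D)^d`, with the norm `(‖u‖² + ‖∇u‖²)^(1/2)`. -/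
def H1 {d : ℕ} (D : Set (Eu d)) : Submodule ℂ (L2Jet D) where
  carrier := {p | ∀ i, IsWeakPartial D i p.fst (p.snd i)}
  zero_mem' := fun _ => IsWeakPartial.zero
  add_mem' := fun hp hq i => (hp i).add (hq i)
  smul_mem' := fun c _ hp i => (hp i).smul c

/-- The function underlying an element of `H¹(D)`. -/
abbrev fn {d : ℕ} {D : Set (Eu d)} (u : H1 D) : L2Domain D := (u : L2Jet D).fst

/-- The weak partial derivative `∂_i u`. -/
abbrev partialDeriv {d : ℕ} {D : Set (Eu d)} (u : H1 D) (i : Fin d) : L2Domain D :=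
  (u : L2Jet D).snd i

/-- The pairs `(φ|_D, φ|_∂D)` in `H¹(D) × L²(∂D)`, with `φ` smooth on `ℝ^d`. -/
def smoothTracePairs {d : ℕ} (D : Set (Eu d)) : Submodule ℂ (H1 D × L2Boundary D) where
  carrier := {p | ∃ φ : Eu d → ℂ, ContDiff ℝ (⊤ : ℕ∞) φ ∧
    fn p.1 =ᵐ[volume.restrict D] φ ∧ p.2 =ᵐ[surfaceMeasure D] φ}
  zero_mem' := ⟨0, contDiff_const, Lp.coeFn_zero .., Lp.coeFn_zero ..⟩
  add_mem' := by
    rintro p q ⟨φ, hφ, h1, h2⟩ ⟨ψ, hψ, h3, h4⟩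
    exact ⟨φ + ψ, hφ.add hψ, (Lp.coeFn_add _ _).trans (h1.add h3),
      (Lp.coeFn_add _ _).trans (h2.add h4)⟩
  smul_mem' := by
    rintro c p ⟨φ, hφ, h1, h2⟩
    exact ⟨c • φ, contDiff_const.smul hφ, (Lp.coeFn_smul _ _).trans (h1.const_smul c),
      (Lp.coeFn_smul _ _).trans (h2.const_smul c)⟩

/-- The graph of the trace operator `H¹(D) → L²(∂D)`, `u ↦ u|_∂D`: the closure of the graph of
the restriction of smooth functions to the boundary. -/
def traceGraph {d : ℕ} (D : Set (Eu d)) : Submodule ℂ (H1 D × L2Boundary D) :=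
  (smoothTracePairs D).topologicalClosure

/-- `u|_∂D = f` in the sense of traces. -/
def HasTrace {d : ℕ} {D : Set (Eu d)} (u : H1 D) (f : L2Boundary D) : Prop :=
  (u, f) ∈ traceGraph D

/-- `H^{1/2}(∂D)`: the space of traces on `∂D` of functions of `H¹(D)`. -/
def HHalf {d : ℕ} (D : Set (Eu d)) : Submodule ℂ (L2Boundary D) :=
  (traceGraph D).map (LinearMap.snd ℂ (H1 D) (L2Boundary D))

/-- The norm of `H^{1/2}(∂D)`: the infimum of `‖u‖_{H¹(D)}` over all `u` with `u|_∂D = f`. -/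
def hHalfNorm {d : ℕ} {D : Set (Eu d)} (f : HHalf D) : ℝ :=
  sInf {r : ℝ | ∃ u : H1 D, HasTrace u (f : L2Boundary D) ∧ r = ‖u‖}

/-- A conductivity: a real bounded measurable function in `D` with a positive lower bound. -/
structure IsConductivity {d : ℕ} (D : Set (Eu d)) (γ : Eu d → ℝ) : Prop where
  memLp_top : MemLp γ ∞ ((volume : Measure (Eu d)).restrict D)
  lower_bound : ∃ γ₀ : ℝ, 0 < γ₀ ∧ ∀ᵐ x ∂((volume : Measure (Eu d)).restrict D), γ₀ ≤ γ x

/-- `‖γ‖_{L^∞(D)}`. -/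
def supNorm {d : ℕ} (D : Set (Eu d)) (γ : Eu d → ℝ) : ℝ :=
  (eLpNorm γ ∞ ((volume : Measure (Eu d)).restrict D)).toReal

/-- The bilinear form `∫_D γ ∇u · ∇v` (no complex conjugation). -/
def energyForm {d : ℕ} {D : Set (Eu d)} (γ : Eu d → ℝ) (u v : H1 D) : ℂ :=
  ∫ x in D, (γ x : ℂ) * ∑ i, partialDeriv u i x * partialDeriv v i x

/-- `u ∈ H¹(D)` is a weak solution of `∇ · (γ ∇u) = 0` in `D`, `u|_∂D = f`; the test functions are
the `w ∈ H¹(D)` with `w|_∂D = 0`. -/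
structure IsDirichletSolution {d : ℕ} {D : Set (Eu d)} (γ : Eu d → ℝ) (f : HHalf D)
    (u : H1 D) : Prop where
  trace : HasTrace u (f : L2Boundary D)
  weak : ∀ w : H1 D, HasTrace w 0 → energyForm γ u w = 0

/-- The solution of the Dirichlet problem with boundary value `f`. -/
def dirichletSolution {d : ℕ} {D : Set (Eu d)} (γ : Eu d → ℝ) (f : HHalf D) : H1 D :=
  Classical.epsilon (IsDirichletSolution γ f)

/-- Some function of `H¹(D)` with trace `g`. -/
def traceExtension {d : ℕ} {D : Set (Eu d)} (g : HHalf D) : H1 D :=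
  Classical.epsilon (fun v : H1 D => HasTrace v (g : L2Boundary D))

/-- The Dirichlet-to-Neumann map, in its weak definition: `dnMap γ f` is the functional
`g ↦ ∫_∂D Λ_γ f g = ∫_D γ ∇u · ∇v` on `H^{1/2}(∂D)`, with `u` the solution of the Dirichlet problem
with boundary value `f` and `v` any function of `H¹(D)` with trace `g`. -/
def dnMap {d : ℕ} {D : Set (Eu d)} (γ : Eu d → ℝ) (f g : HHalf D) : ℂ :=
  energyForm γ (dirichletSolution γ f) (traceExtension g)

/-- A family `X_α`, `α ∈ ℕ²`, of independent complex random variables with `E X_α = 0`,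
`E (X_α conj X_α) = 1` and `E (X_α X_α) = 0`. -/
structure IsNoise {Ω : Type*} [MeasurableSpace Ω] (P : Measure Ω) (X : ℕ × ℕ → Ω → ℂ) : Prop where
  measurable : ∀ α, Measurable (X α)
  indep : iIndepFun X P
  mean : ∀ α, ∫ ω, X α ω ∂P = 0
  covariance : ∀ α, ∫ ω, X α ω * conj (X α ω) ∂P = 1
  relation : ∀ α, ∫ ω, X α ω * X α ω ∂P = 0

theorem IsNoise.memLp {Ω : Type*} [MeasurableSpace Ω] {P : Measure Ω} {X : ℕ × ℕ → Ω → ℂ}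
    (hX : IsNoise P X) (α : ℕ × ℕ) : MemLp (X α) 2 P := by
  rw [memLp_two_iff_integrable_sq_norm (hX.measurable α).aestronglyMeasurable]
  have h : Integrable (fun ω => X α ω * conj (X α ω)) P := by
    by_contra hn
    have := hX.covariance α
    rw [integral_undef hn] at this
    exact zero_ne_one this
  refine h.norm.congr (Eventually.of_forall fun ω => ?_)
  simp [sq]

/-- The coefficient `(f|e_{α₁}) (g|e_{α₂})`, where `(φ|ψ) = ∫_∂D φ conj ψ`. -/
def noiseCoeff {d : ℕ} {D : Set (Eu d)} (e : HilbertBasis ℕ ℂ (L2Boundary D)) (f g : HHalf D)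
    (α : ℕ × ℕ) : ℂ :=
  ⟪e α.1, (f : L2Boundary D)⟫_ℂ * ⟪e α.2, (g : L2Boundary D)⟫_ℂ

/-- The term `(f|e_{α₁}) (g|e_{α₂}) X_α` of the noise, as an element of `L²(Ω)`. -/
def noiseTerm {d : ℕ} {D : Set (Eu d)} {Ω : Type*} [MeasurableSpace Ω] {P : Measure Ω}
    (e : HilbertBasis ℕ ℂ (L2Boundary D)) {X : ℕ × ℕ → Ω → ℂ} (hX : IsNoise P X) (f g : HHalf D)
    (α : ℕ × ℕ) : Lp ℂ 2 P :=
  noiseCoeff e f g α • (hX.memLp α).toLp (X α)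

/-- The noisy data `∫_∂D Λ_γ f g + ∑_α (f|e_{α₁}) (g|e_{α₂}) X_α`, the series being taken in
`L²(Ω)`. -/
def noisyData {d : ℕ} {D : Set (Eu d)} {Ω : Type*} [MeasurableSpace Ω] {P : Measure Ω}
    [IsProbabilityMeasure P] (γ : Eu d → ℝ) (e : HilbertBasis ℕ ℂ (L2Boundary D))
    {X : ℕ × ℕ → Ω → ℂ} (hX : IsNoise P X) (f g : HHalf D) : Lp ℂ 2 P :=
  Lp.const 2 P (dnMap γ f g) + ∑' α, noiseTerm e hX f g α

end Calderon

end

/-! The noise and the Dirichlet-to-Neumann form are estimated separately.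

Noise: independence, zero mean and unit variance make the `X α` orthonormal in `L²(Ω)`, and Parseval
in each index shows that the coefficients are square summable with sum `‖f‖² ‖g‖²` (norms of
`L²(∂D)`). Hence the series converges unconditionally, with norm `‖f‖ ‖g‖` for every basis
(`norm_tsum_noiseTerm_sq`). Along an enumeration the real and imaginary partial sums are
`L¹`-bounded martingales, so they converge almost surely (`ae_tendsto_sum_of_tendsto_Lp`).

Dirichlet-to-Neumann form: the energy form of `u, v` is the inner product of `√γ ∇ū` and `√γ ∇v`.
Friedrichs' inequality (`exists_norm_fn_le`) bounds `w ↦ √γ ∇w` below on functions of trace zero, so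
its range there is closed, and projecting onto it solves the Dirichlet problem. The solution has
least energy among all extensions of `f`; Cauchy–Schwarz then bounds the form by `‖γ‖_∞ ‖F‖ ‖G‖` for
any extensions `F`, `G`, independently of the lower bound of `γ` (`norm_dnMap_le`).

The two bounds meet through the trace inequality (`exists_norm_le_of_hasTrace`). It and Friedrichs'
inequality are proved for smooth functions by the fundamental theorem of calculus on parallel
segments, going from the boundary into `D` for the former and from a point of `D` to its exit point
for the latter. They extend to `H¹(D)` by closure of the trace graph. -/

namespace Calderon

/-! ### The noise series: unconditional convergence in `L²` and almost sure convergence -/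

section Noise

variable {Ω : Type*} [MeasurableSpace Ω] {P : Measure Ω}

theorem Orthonormal.summable_smul {ι E : Type*} [NormedAddCommGroup E] [InnerProductSpace ℂ E]
    [CompleteSpace E] {v : ι → E} (hv : Orthonormal ℂ v) {c : ι → ℂ}
    (hc : Summable fun i => ‖c i‖ ^ 2) : Summable fun i => c i • v i := by
  have h := (hv.orthogonalFamily.summable_iff_norm_sq_summable c).2 hc
  simpa using h

theorem Orthonormal.norm_tsum_smul_sq {ι E : Type*} [NormedAddCommGroup E]
    [InnerProductSpace ℂ E] [CompleteSpace E] {v : ι → E} (hv : Orthonormal ℂ v) {c : ι → ℂ}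
    (hc : Summable fun i => ‖c i‖ ^ 2) : ‖∑' i, c i • v i‖ ^ 2 = ∑' i, ‖c i‖ ^ 2 := by
  have h1 := ((Orthonormal.summable_smul hv hc).hasSum.norm).pow 2
  refine tendsto_nhds_unique h1 (hc.hasSum.congr fun s => ?_)
  have := hv.orthogonalFamily.norm_sum c s
  simpa using this.symm

theorem IsNoise.orthonormal {X : ℕ × ℕ → Ω → ℂ} (hX : IsNoise P X) :
    Orthonormal ℂ fun α => (hX.memLp α).toLp (X α) := by
  rw [orthonormal_iff_ite]
  intro α β
  have h : ⟪(hX.memLp α).toLp (X α), (hX.memLp β).toLp (X β)⟫_ℂ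
      = ∫ ω, conj (X α ω) * X β ω ∂P := by
    rw [L2.inner_def]
    refine integral_congr_ae ?_
    filter_upwards [(hX.memLp α).coeFn_toLp, (hX.memLp β).coeFn_toLp] with ω h1 h2
    rw [h1, h2, RCLike.inner_apply, mul_comm]
  rw [h]
  split_ifs with hαβ
  · subst hαβ
    rw [← hX.covariance α]
    simp_rw [mul_comm]
  · have hi : IndepFun (fun ω => conj (X α ω)) (X β) P :=
      (hX.indep.indepFun hαβ).comp Complex.continuous_conj.measurable measurable_id
    have := hi.integral_fun_mul_eq_mul_integral
      (Complex.continuous_conj.measurable.comp (hX.measurable α)).aestronglyMeasurable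
      (hX.measurable β).aestronglyMeasurable
    rw [this, hX.mean β, mul_zero]

/-- Partial sums of independent centred variables form a martingale for the natural filtration, and
an `L¹`-bounded martingale converges almost surely. -/
theorem ae_exists_tendsto_sum_of_iIndepFun {Y : ℕ → Ω → ℝ} (hY : ∀ n, Measurable (Y n))
    (hi : iIndepFun Y P) (hL : ∀ n, Integrable (Y n) P) (hm : ∀ n, ∫ ω, Y n ω ∂P = 0)
    {R : ℝ≥0} (hR : ∀ n, eLpNorm (fun ω => ∑ k ∈ Finset.range (n + 1), Y k ω) 1 P ≤ R) :
    ∀ᵐ ω ∂P, ∃ c, Tendsto (fun n => ∑ k ∈ Finset.range n, Y k ω) atTop (𝓝 c) := by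
  have := hi.isProbabilityMeasure
  have hs : ∀ n, StronglyMeasurable (Y n) := fun n => (hY n).stronglyMeasurable
  -- Time `n` carries the sum over `range (n + 1)`, whose last term `Y n` is the newest variable
  -- known at time `n`.
  have hadp : StronglyAdapted (Filtration.natural Y hs)
      fun n ω => ∑ k ∈ Finset.range (n + 1), Y k ω := by
    intro n
    refine Finset.stronglyMeasurable_fun_sum _ fun k hk => ?_
    exact (Filtration.stronglyAdapted_natural hs k).mono
      ((Filtration.natural Y hs).mono (by simpa [Nat.lt_succ_iff] using hk))
  have hint : ∀ n, Integrable (fun ω => ∑ k ∈ Finset.range (n + 1), Y k ω) P := fun n =>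
    integrable_finsetSum _ fun k _ => hL k
  have hmart : Martingale (fun n ω => ∑ k ∈ Finset.range (n + 1), Y k ω)
      (Filtration.natural Y hs) P := by
    refine martingale_nat hadp hint fun n => ?_
    have h1 : (fun ω => ∑ k ∈ Finset.range (n + 1 + 1), Y k ω)
        = (fun ω => ∑ k ∈ Finset.range (n + 1), Y k ω) + Y (n + 1) := by
      ext ω; simp [Finset.sum_range_succ]
    rw [h1]
    have h2 := condExp_add (hint n) (hL (n + 1)) (Filtration.natural Y hs n)
    have h3 := iIndepFun.condExp_natural_ae_eq_of_lt hs hi (Nat.lt_succ_self n)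
    have h4 := condExp_of_stronglyMeasurable ((Filtration.natural Y hs).le n) (hadp n) (hint n)
    filter_upwards [h2, h3] with ω h2 h3
    rw [h2, Pi.add_apply, h4, h3, hm, add_zero]
  filter_upwards [hmart.submartingale.exists_ae_tendsto_of_bdd hR] with ω ⟨c, hc⟩
  exact ⟨c, (tendsto_add_atTop_iff_nat 1).1 hc⟩

/-- Independence supplies an almost sure limit of the whole sequence; `L²` convergence identifies it
with `S` through an almost everywhere convergent subsequence. -/
theorem ae_tendsto_sum_of_tendsto_Lp {Z : ℕ → Ω → ℂ} (hZ : ∀ n, Measurable (Z n))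
    (hi : iIndepFun Z P) (hL : ∀ n, MemLp (Z n) 2 P) (hm : ∀ n, ∫ ω, Z n ω ∂P = 0)
    {S : Lp ℂ 2 P}
    (hS : Tendsto (fun n => ∑ k ∈ Finset.range n, (hL k).toLp (Z k)) atTop (𝓝 S)) :
    ∀ᵐ ω ∂P, Tendsto (fun n => ∑ k ∈ Finset.range n, Z k ω) atTop (𝓝 (S ω)) := by
  have := hi.isProbabilityMeasure
  have hcoe : ∀ n, (∑ k ∈ Finset.range n, (hL k).toLp (Z k) : Lp ℂ 2 P) =ᵐ[P]
      fun ω => ∑ k ∈ Finset.range n, Z k ω := by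
    intro n
    have h := ae_all_iff.2 fun k => (hL k).coeFn_toLp
    filter_upwards [Lp.coeFn_finsetSum (Finset.range n) fun k => (hL k).toLp (Z k), h]
      with ω h1 h2
    rw [h1, Finset.sum_apply]
    exact Finset.sum_congr rfl fun k _ => h2 k
  obtain ⟨R, hR⟩ : ∃ R : ℝ, ∀ n, ‖∑ k ∈ Finset.range n, (hL k).toLp (Z k)‖ ≤ R := by
    obtain ⟨R, hR⟩ := hS.norm.bddAbove_range
    exact ⟨R, fun n => hR ⟨n, rfl⟩⟩
  -- On a probability space the `L²` bound of a convergent sequence is also an `L¹` bound.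
  have hbd : ∀ n, eLpNorm (fun ω => ∑ k ∈ Finset.range n, Z k ω) 1 P ≤ R.toNNReal := by
    intro n
    calc eLpNorm (fun ω => ∑ k ∈ Finset.range n, Z k ω) 1 P
        ≤ eLpNorm (fun ω => ∑ k ∈ Finset.range n, Z k ω) 2 P :=
          eLpNorm_le_eLpNorm_of_exponent_le (by norm_num)
            (Finset.measurable_fun_sum _ fun k _ => hZ k).aestronglyMeasurable
      _ = ‖∑ k ∈ Finset.range n, (hL k).toLp (Z k)‖ₑ := by
          rw [Lp.enorm_def, eLpNorm_congr_ae (hcoe n)]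
      _ ≤ R.toNNReal := by
          rw [← ofReal_norm]
          exact ENNReal.ofReal_le_ofReal (hR n)
  have hint : ∀ n, Integrable (Z n) P := fun n => (hL n).integrable (by norm_num)
  have hre := ae_exists_tendsto_sum_of_iIndepFun (Y := fun n ω => (Z n ω).re)
    (fun n => Complex.measurable_re.comp (hZ n))
    (hi.comp (fun _ => Complex.re) fun _ => Complex.measurable_re)
    (fun n => (hint n).re)
    (fun n => by
      have := integral_re (hint n)
      simp only [RCLike.re_to_complex] at this
      rw [this, hm]; simp)
    (R := R.toNNReal) (fun n => (eLpNorm_mono fun ω => by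
      rw [← Complex.re_sum]; exact Complex.abs_re_le_norm _).trans (hbd (n + 1)))
  have him := ae_exists_tendsto_sum_of_iIndepFun (Y := fun n ω => (Z n ω).im)
    (fun n => Complex.measurable_im.comp (hZ n))
    (hi.comp (fun _ => Complex.im) fun _ => Complex.measurable_im)
    (fun n => (hint n).im)
    (fun n => by
      have := integral_im (hint n)
      simp only [RCLike.im_to_complex] at this
      rw [this, hm]; simp)
    (R := R.toNNReal) (fun n => (eLpNorm_mono fun ω => by
      rw [← Complex.im_sum]; exact Complex.abs_im_le_norm _).trans (hbd (n + 1)))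
  have hmeas : TendstoInMeasure P
      (fun n => ((∑ k ∈ Finset.range n, (hL k).toLp (Z k) : Lp ℂ 2 P) : Ω → ℂ)) atTop S :=
    tendstoInMeasure_of_tendsto_Lp hS
  obtain ⟨ns, hns, hsub⟩ := hmeas.exists_seq_tendsto_ae
  filter_upwards [hre, him, hsub, ae_all_iff.2 hcoe] with ω ⟨a, ha⟩ ⟨b, hb⟩ hω hc
  have hab : Tendsto (fun n => ∑ k ∈ Finset.range n, Z k ω) atTop (𝓝 (a + b * Complex.I)) := by
    have h1 := ((Complex.continuous_ofReal.tendsto a).comp ha).add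
      (((Complex.continuous_ofReal.tendsto b).comp hb).mul_const Complex.I)
    refine h1.congr fun n => ?_
    simp only [Function.comp]
    rw [← Complex.re_sum, ← Complex.im_sum, Complex.re_add_im]
  have h2 := hab.comp hns.tendsto_atTop
  have h3 : Tendsto (fun i => ∑ k ∈ Finset.range (ns i), Z k ω) atTop (𝓝 (S ω)) :=
    hω.congr fun i => hc (ns i)
  rwa [tendsto_nhds_unique h2 h3] at hab

variable {d : ℕ} {D : Set (Eu d)}

theorem hasSum_norm_inner_sq (e : HilbertBasis ℕ ℂ (L2Boundary D)) (f : L2Boundary D) :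
    HasSum (fun n => ‖⟪e n, f⟫_ℂ‖ ^ 2) (‖f‖ ^ 2) := by
  have h := Complex.hasSum_re (e.hasSum_inner_mul_inner f f)
  rw [← RCLike.re_to_complex, inner_self_eq_norm_sq] at h
  refine h.congr_fun fun n => ?_
  rw [← inner_conj_symm f (e n), ← Complex.normSq_eq_conj_mul_self, Complex.ofReal_re,
    Complex.normSq_eq_norm_sq]

theorem hasSum_norm_noiseCoeff_sq (e : HilbertBasis ℕ ℂ (L2Boundary D)) (f g : HHalf D) :
    HasSum (fun α => ‖noiseCoeff e f g α‖ ^ 2)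
      (‖(f : L2Boundary D)‖ ^ 2 * ‖(g : L2Boundary D)‖ ^ 2) := by
  have h1 := hasSum_norm_inner_sq e f
  have h2 := hasSum_norm_inner_sq e g
  have h3 := h1.mul h2 (h1.summable.mul_of_nonneg h2.summable
    (fun _ => by positivity) (fun _ => by positivity))
  refine h3.congr_fun fun α => ?_
  simp [noiseCoeff, mul_pow]

variable {X : ℕ × ℕ → Ω → ℂ}

theorem summable_noiseTerm (e : HilbertBasis ℕ ℂ (L2Boundary D)) (hX : IsNoise P X)
    (f g : HHalf D) : Summable (noiseTerm e hX f g) :=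
  Orthonormal.summable_smul hX.orthonormal (hasSum_norm_noiseCoeff_sq e f g).summable

theorem norm_tsum_noiseTerm_sq (e : HilbertBasis ℕ ℂ (L2Boundary D)) (hX : IsNoise P X)
    (f g : HHalf D) : ‖∑' α, noiseTerm e hX f g α‖ ^ 2 =
      ‖(f : L2Boundary D)‖ ^ 2 * ‖(g : L2Boundary D)‖ ^ 2 := by
  rw [← (hasSum_norm_noiseCoeff_sq e f g).tsum_eq]
  exact Orthonormal.norm_tsum_smul_sq hX.orthonormal (hasSum_norm_noiseCoeff_sq e f g).summable

theorem ae_tendsto_sum_noise (e : HilbertBasis ℕ ℂ (L2Boundary D)) (hX : IsNoise P X)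
    (f g : HHalf D) (κ : ℕ ≃ ℕ × ℕ) : ∀ᵐ ω ∂P,
      Tendsto (fun n => ∑ k ∈ Finset.range n, noiseCoeff e f g (κ k) * X (κ k) ω) atTop
        (𝓝 ((∑' α, noiseTerm e hX f g α : Lp ℂ 2 P) ω)) := by
  have hL : ∀ n, MemLp (fun ω => noiseCoeff e f g (κ n) * X (κ n) ω) 2 P := fun n =>
    (hX.memLp (κ n)).const_mul _
  refine ae_tendsto_sum_of_tendsto_Lp (Z := fun n ω => noiseCoeff e f g (κ n) * X (κ n) ω)
    (fun n => (hX.measurable _).const_mul _) ?_ hL ?_ ?_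
  · exact (hX.indep.precomp κ.injective).comp (fun n z => noiseCoeff e f g (κ n) * z)
      fun n => measurable_const_mul _
  · intro n
    rw [integral_const_mul, hX.mean, mul_zero]
  -- Unconditional summability is what allows an arbitrary enumeration `κ`.
  · exact ((κ.hasSum_iff).2 (summable_noiseTerm e hX f g).hasSum).tendsto_sum_nat

end Noise

end Calderon

namespace Calderon

/-! ### One-dimensional estimates on segments, and projection along a direction -/

section Slicing

variable {d n : ℕ}

/-- Fundamental theorem of calculus on `[0, t]`, Cauchy–Schwarz for the integral, and `(a + b)² ≤
2a² + 2b²`. -/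
theorem enorm_sq_le_of_contDiff {g : ℝ → ℂ} (hg : ContDiff ℝ 1 g) {t : ℝ} (ht : 0 ≤ t) :
    ‖g 0‖ₑ ^ 2 ≤ 2 * ‖g t‖ₑ ^ 2 +
      2 * ENNReal.ofReal t * ∫⁻ s in Set.Ioo 0 t, ‖deriv g s‖ₑ ^ 2 := by
  have hc : Continuous (deriv g) := hg.continuous_deriv le_rfl
  have h1 : ∫ s in (0 : ℝ)..t, deriv g s = g t - g 0 :=
    intervalIntegral.integral_deriv_eq_sub
      (fun s _ => (hg.differentiable one_ne_zero).differentiableAt) (hc.intervalIntegrable _ _)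
  have h2 : ‖g 0‖ₑ ≤ ‖g t‖ₑ + ∫⁻ s in Set.Ioo 0 t, ‖deriv g s‖ₑ := by
    have h3 : g 0 = g t - ∫ s in Set.Ioo 0 t, deriv g s := by
      rw [← integral_Ioc_eq_integral_Ioo, ← intervalIntegral.integral_of_le ht, h1]; ring
    calc ‖g 0‖ₑ = ‖g t - ∫ s in Set.Ioo 0 t, deriv g s‖ₑ := by rw [← h3]
      _ ≤ ‖g t‖ₑ + ‖∫ s in Set.Ioo 0 t, deriv g s‖ₑ := enorm_sub_le
      _ ≤ _ := by gcongr; exact enorm_integral_le_lintegral_enorm _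
  have h4 : (∫⁻ s in Set.Ioo 0 t, ‖deriv g s‖ₑ) ^ 2 ≤
      ENNReal.ofReal t * ∫⁻ s in Set.Ioo 0 t, ‖deriv g s‖ₑ ^ 2 := by
    have h := ENNReal.lintegral_mul_le_Lp_mul_Lq (volume.restrict (Set.Ioo 0 t))
      Real.HolderConjugate.two_two (f := fun _ => 1) (g := fun s => ‖deriv g s‖ₑ)
      aemeasurable_const hc.measurable.enorm.aemeasurable
    simp only [Pi.mul_apply, one_mul, lintegral_const, Measure.restrict_apply
      MeasurableSet.univ, Set.univ_inter, Real.volume_Ioo, sub_zero, ENNReal.rpow_two] at h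
    calc _ ≤ _ := pow_le_pow_left₀ zero_le h 2
      _ = _ := by
        rw [mul_pow, one_pow, one_mul]
        simp only [← ENNReal.rpow_two, ← ENNReal.rpow_mul]
        norm_num
  have h5 := ENNReal.rpow_add_le_mul_rpow_add_rpow ‖g t‖ₑ
    (∫⁻ s in Set.Ioo 0 t, ‖deriv g s‖ₑ) (p := 2) (by norm_num)
  simp only [ENNReal.rpow_two] at h5
  norm_num at h5
  calc ‖g 0‖ₑ ^ 2 ≤ (‖g t‖ₑ + ∫⁻ s in Set.Ioo 0 t, ‖deriv g s‖ₑ) ^ 2 :=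
        pow_le_pow_left₀ zero_le h2 2
    _ ≤ _ := h5
    _ ≤ _ := by rw [mul_add, mul_assoc 2]; gcongr

theorem enorm_sq_le_along_line {φ : Eu d → ℂ} (hφ : ContDiff ℝ (⊤ : ℕ∞) φ) (x e : Eu d) {t : ℝ}
    (ht : 0 ≤ t) : ‖φ x‖ₑ ^ 2 ≤ 2 * ‖φ (x + t • e)‖ₑ ^ 2 +
      2 * ENNReal.ofReal t * ∫⁻ s in Set.Ioo 0 t, ‖fderiv ℝ φ (x + s • e) e‖ₑ ^ 2 := by
  have hg : ContDiff ℝ 1 (fun s : ℝ => φ (x + s • e)) :=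
    (hφ.of_le (by exact_mod_cast le_top)).comp (by fun_prop)
  have hd : ∀ s : ℝ, deriv (fun s : ℝ => φ (x + s • e)) s = fderiv ℝ φ (x + s • e) e := by
    intro s
    have h1 : HasDerivAt (fun s : ℝ => x + s • e) e s := by
      simpa using ((hasDerivAt_id s).smul_const e).const_add x
    exact ((hφ.differentiable (by simp) _).hasFDerivAt.comp_hasDerivAt s h1).deriv
  simpa [hd] using enorm_sq_le_of_contDiff hg ht

theorem enorm_fderiv_sq_le {φ : Eu d → ℂ} {e : Eu d} (he : ‖e‖ = 1) (x : Eu d) :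
    ‖fderiv ℝ φ x e‖ₑ ^ 2 ≤ ∑ i, ‖fderiv ℝ φ x (EuclideanSpace.single i 1)‖ₑ ^ 2 := by
  have h1 : fderiv ℝ φ x e = ∑ i, e i • fderiv ℝ φ x (EuclideanSpace.single i 1) := by
    conv_lhs => rw [← (EuclideanSpace.basisFun (Fin d) ℝ).sum_repr e]
    simp
  have h2 : ‖fderiv ℝ φ x e‖ ^ 2 ≤ ∑ i, ‖fderiv ℝ φ x (EuclideanSpace.single i 1)‖ ^ 2 := by
    calc ‖fderiv ℝ φ x e‖ ^ 2
        ≤ (∑ i, ‖e i‖ * ‖fderiv ℝ φ x (EuclideanSpace.single i 1)‖) ^ 2 := by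
          gcongr
          rw [h1]
          exact (norm_sum_le _ _).trans (Finset.sum_le_sum fun i _ => (norm_smul_le _ _))
      _ ≤ (∑ i, ‖e i‖ ^ 2) * ∑ i, ‖fderiv ℝ φ x (EuclideanSpace.single i 1)‖ ^ 2 :=
          Finset.sum_mul_sq_le_sq_mul_sq _ _ _
      _ = _ := by rw [← EuclideanSpace.norm_sq_eq, he]; simp
  have h3 := ENNReal.ofReal_le_ofReal h2
  rw [ENNReal.ofReal_sum_of_nonneg fun i _ => by positivity] at h3
  simpa [ENNReal.ofReal_pow, ofReal_norm] using h3

variable (y : Eu d ≃ₗᵢ[ℝ] WithLp 2 (Eu n × ℝ))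

/-- The unit vector of the last coordinate direction in the Euclidean coordinates `y`. -/
noncomputable def vertical : Eu d := y.symm (WithLp.toLp 2 (0, 1))

theorem norm_vertical : ‖vertical y‖ = 1 := by
  simp [vertical]

theorem apply_add_smul_vertical (x : Eu d) (t : ℝ) :
    (y (x + t • vertical y)).fst = (y x).fst ∧
      (y (x + t • vertical y)).snd = (y x).snd + t := by
  simp [vertical]

theorem measurePreserving_coords :
    MeasurePreserving (fun x => WithLp.ofLp (y x)) volume
      ((volume : Measure (Eu n)).prod (volume : Measure ℝ)) :=
  (WithLp.volume_preserving_ofLp (Eu n) ℝ).comp y.measurePreserving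

/-- An orthogonal projection is 1-Lipschitz, so it does not increase Hausdorff measure, which on
`ℝ^n` is normalised to be Lebesgue measure. -/
theorem volume_image_fst_le (A : Set (Eu d)) :
    volume ((fun x => (y x).fst) '' A) ≤ Measure.euclideanHausdorffMeasure n A := by
  have hl : LipschitzWith 1 (fun x => (y x).fst) :=
    LipschitzWith.of_dist_le_mul fun a b => by
      rw [NNReal.coe_one, one_mul, ← y.dist_map a b, dist_eq_norm, dist_eq_norm, ← WithLp.sub_fst]
      exact WithLp.norm_fst_le _ (y a - y b)
  rw [← EuclideanSpace.euclideanHausdorffMeasure_eq_volume n,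
    Measure.euclideanHausdorffMeasure_def, Measure.euclideanHausdorffMeasure_def]
  simp only [Measure.smul_apply]
  gcongr
  simpa using hl.hausdorffMeasure_image_le (d := (n : ℝ)) (by positivity) A

theorem volume_cylinder_le (A : Set (Eu d)) (R : ℝ) :
    volume {x : Eu d | (y x).fst ∈ (fun x => (y x).fst) '' A ∧ |(y x).snd| ≤ R} ≤
      ENNReal.ofReal (2 * R) * Measure.euclideanHausdorffMeasure n A := by
  have h1 : {x : Eu d | (y x).fst ∈ (fun x => (y x).fst) '' A ∧ |(y x).snd| ≤ R} =
      (fun x => WithLp.ofLp (y x)) ⁻¹' (((fun x => (y x).fst) '' A) ×ˢ Set.Icc (-R) R) := by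
    ext x
    simp only [Set.mem_ofPred_eq, Set.mem_preimage, Set.mem_prod, Set.mem_Icc, abs_le]
    rfl
  -- The projected set need not be measurable; the preimage formula for a measurable embedding and
  -- `Measure.prod_prod` hold for arbitrary sets.
  have h2 : MeasurableEmbedding (fun x => WithLp.ofLp (y x)) :=
    (y.toHomeomorph.toMeasurableEquiv.trans
      (MeasurableEquiv.toLp 2 (Eu n × ℝ)).symm).measurableEmbedding
  rw [h1, (measurePreserving_coords y).measure_preimage_emb h2, Measure.prod_prod,
    Real.volume_Icc, mul_comm, show R - -R = 2 * R by ring]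
  gcongr
  exact volume_image_fst_le y A

end Slicing

end Calderon

namespace Calderon

/-! ### Friedrichs' inequality for smooth functions -/

section Poincare

variable {d n : ℕ}

/-- The first time at which the half-line `x - t e`, `t ≥ 0`, is outside of `D`. -/
noncomputable def exitTime (D : Set (Eu d)) (e x : Eu d) : ℝ :=
  sInf {t : ℝ | 0 ≤ t ∧ x - t • e ∉ D}

variable {D : Set (Eu d)} {e : Eu d} {R : ℝ}

theorem sub_smul_notMem_of_subset_ball (he : ‖e‖ = 1) (hD : D ⊆ Metric.ball 0 R)
    {x : Eu d} (hx : x ∈ D) : x - (2 * R) • e ∉ D := fun h => by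
  have h1 := mem_ball_zero_iff.1 (hD h)
  have h2 := mem_ball_zero_iff.1 (hD hx)
  have h3 : ‖(2 * R) • e‖ ≤ ‖x‖ + ‖x - (2 * R) • e‖ := by
    have := norm_sub_le x (x - (2 * R) • e)
    rwa [sub_sub_cancel] at this
  rw [norm_smul, he, mul_one, Real.norm_eq_abs] at h3
  linarith [le_abs_self (2 * R)]

theorem exitTime_mem (ho : IsOpen D) (he : ‖e‖ = 1) (hD : D ⊆ Metric.ball 0 R) (x : Eu d) :
    0 ≤ exitTime D e x ∧ x - exitTime D e x • e ∉ D := by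
  have hcl : IsClosed {t : ℝ | 0 ≤ t ∧ x - t • e ∉ D} :=
    isClosed_Ici.inter (ho.isClosed_compl.preimage (by fun_prop))
  have hne : {t : ℝ | 0 ≤ t ∧ x - t • e ∉ D}.Nonempty := by
    by_cases hx : x ∈ D
    · refine ⟨2 * R, ?_, sub_smul_notMem_of_subset_ball he hD hx⟩
      have := mem_ball_zero_iff.1 (hD hx)
      linarith [norm_nonneg x]
    · exact ⟨0, le_rfl, by simpa using hx⟩
  exact hcl.csInf_mem hne ⟨0, fun t ht => ht.1⟩

theorem exitTime_le {x : Eu d} {t : ℝ} (ht : 0 ≤ t) (h : x - t • e ∉ D) : exitTime D e x ≤ t :=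
  csInf_le ⟨0, fun _ ht => ht.1⟩ ⟨ht, h⟩

theorem sub_smul_mem_of_lt_exitTime {x : Eu d} {t : ℝ} (ht : 0 ≤ t) (h : t < exitTime D e x) :
    x - t • e ∈ D := by
  by_contra hn
  exact absurd (exitTime_le ht hn) (not_le.2 h)

theorem exitTime_le_of_mem (he : ‖e‖ = 1) (hD : D ⊆ Metric.ball 0 R) {x : Eu d} (hx : x ∈ D) :
    exitTime D e x ≤ 2 * R := by
  refine exitTime_le ?_ (sub_smul_notMem_of_subset_ball he hD hx)
  have := mem_ball_zero_iff.1 (hD hx)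
  linarith [norm_nonneg x]

theorem sub_exitTime_smul_mem_frontier (ho : IsOpen D) (he : ‖e‖ = 1)
    (hD : D ⊆ Metric.ball 0 R) {x : Eu d} (hx : x ∈ D) :
    x - exitTime D e x • e ∈ frontier D := by
  obtain ⟨h0, h1⟩ := exitTime_mem ho he hD x
  rw [ho.frontier_eq]
  refine ⟨?_, h1⟩
  have hpos : 0 < exitTime D e x := by
    refine h0.lt_of_ne fun h => h1 ?_
    rwa [← h, zero_smul, sub_zero]
  have hcont : ContinuousWithinAt (fun t : ℝ => x - t • e) (Set.Ico 0 (exitTime D e x))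
      (exitTime D e x) := by fun_prop
  refine hcont.mem_closure ?_ fun t ht => sub_smul_mem_of_lt_exitTime ht.1 ht.2
  rw [closure_Ico hpos.ne]
  exact ⟨h0, le_rfl⟩

open scoped Pointwise in
theorem measurable_exitTime (ho : IsOpen D) (he : ‖e‖ = 1) (hD : D ⊆ Metric.ball 0 R) :
    Measurable (exitTime D e) := by
  refine measurable_of_Iic fun a => ?_
  -- The exit time is at most `a` exactly when `x` is reached from the complement of `D` by moving
  -- along `e` for a time in `[0, a]`. A closed set plus a compact set is closed.
  have h : exitTime D e ⁻¹' Set.Iic a = Dᶜ + (fun t : ℝ => t • e) '' Set.Icc 0 a := by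
    ext x
    simp only [Set.mem_preimage, Set.mem_Iic, Set.mem_add, Set.mem_image, Set.mem_Icc,
      Set.mem_compl_iff]
    constructor
    · intro h
      obtain ⟨h0, h1⟩ := exitTime_mem ho he hD x
      exact ⟨_, h1, _, ⟨_, ⟨h0, h⟩, rfl⟩, sub_add_cancel _ _⟩
    · rintro ⟨z, hz, _, ⟨t, ⟨h0, h1⟩, rfl⟩, rfl⟩
      exact (exitTime_le h0 (by simpa using hz)).trans h1
  rw [h]
  exact (ho.isClosed_compl.add_right_of_isCompact
    (isCompact_Icc.image (by fun_prop))).measurableSet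

/-- Points of `D` that exit through `A` lie in the cylinder of height `2R` over the projection of `A
∩ frontier D`, so no regularity of the boundary is needed. -/
theorem map_exitPoint_le (y : Eu d ≃ₗᵢ[ℝ] WithLp 2 (Eu n × ℝ)) (ho : IsOpen D) (hD : D ⊆ Metric.ball 0 R) :
    (volume.restrict D).map (fun x => x - exitTime D (vertical y) x • vertical y) ≤
      ENNReal.ofReal (2 * R) • (Measure.euclideanHausdorffMeasure n).restrict (frontier D) := by
  have he := norm_vertical y
  have hb : Measurable (fun x => x - exitTime D (vertical y) x • vertical y) :=
    measurable_id.sub ((measurable_exitTime ho he hD).smul_const _)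
  refine Measure.le_iff.2 fun A hA => ?_
  rw [Measure.map_apply hb hA, Measure.restrict_apply (hb hA), Measure.smul_apply,
    Measure.restrict_apply hA, smul_eq_mul]
  refine (measure_mono ?_).trans (volume_cylinder_le y (A ∩ frontier D) R)
  rintro x ⟨hxA, hxD⟩
  refine ⟨⟨_, ⟨hxA, sub_exitTime_smul_mem_frontier ho he hD hxD⟩, ?_⟩, ?_⟩
  · have := (apply_add_smul_vertical y x (-exitTime D (vertical y) x)).1
    simpa [sub_eq_add_neg] using this
  · have h1 : |(y x).snd| ≤ ‖y x‖ := WithLp.norm_snd_le _ (y x)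
    rw [y.norm_map] at h1
    exact h1.trans (mem_ball_zero_iff.1 (hD hxD)).le

theorem lintegral_sub_smul_le {k : Eu d → ℝ≥0∞} (hk : Measurable k) (v : Eu d) {T : ℝ} :
    ∫⁻ x, ∫⁻ s in Set.Ioo 0 T, k (x - s • v) = ENNReal.ofReal T * ∫⁻ x, k x := by
  rw [lintegral_lintegral_swap]
  · have : ∀ s : ℝ, ∫⁻ x, k (x - s • v) = ∫⁻ x, k x := fun s =>
      lintegral_sub_right_eq_self k (s • v)
    simp [this, mul_comm]
  · have h : Measurable fun p : Eu d × ℝ => p.1 - p.2 • v := by fun_prop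
    exact (hk.comp h).aemeasurable

/-- Each point of `D` is compared with its exit point along a segment of length at most `2R`. After
integration over `D`, `map_exitPoint_le` turns the exit values into a surface integral. -/
theorem lintegral_enorm_sq_le_frontier (y : Eu d ≃ₗᵢ[ℝ] WithLp 2 (Eu n × ℝ)) (ho : IsOpen D) (hD : D ⊆ Metric.ball 0 R) :
    ∃ C : ℝ≥0, ∀ φ : Eu d → ℂ, ContDiff ℝ (⊤ : ℕ∞) φ →
      ∫⁻ x in D, ‖φ x‖ₑ ^ 2 ≤ C * (∫⁻ x in frontier D, ‖φ x‖ₑ ^ 2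
          ∂(Measure.euclideanHausdorffMeasure n) +
        ∑ i, ∫⁻ x in D, ‖fderiv ℝ φ x (EuclideanSpace.single i 1)‖ₑ ^ 2) := by
  have he := norm_vertical y
  have hτ := measurable_exitTime ho he hD
  have hb : Measurable (fun x => x - exitTime D (vertical y) x • vertical y) :=
    measurable_id.sub (hτ.smul_const _)
  -- The first summand is the weight of the exit values. In the second, one factor `2R` is the
  -- segment length from Cauchy–Schwarz, the other comes from integrating over `s`.
  refine ⟨2 * (2 * R).toNNReal + 2 * (2 * R).toNNReal * (2 * R).toNNReal, fun φ hφ => ?_⟩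
  have hcφ : Continuous φ := hφ.continuous
  have hcd : ∀ v, Continuous fun x => fderiv ℝ φ x v := fun v =>
    (hφ.continuous_fderiv (by simp)).clm_apply continuous_const
  set q : Eu d → ℝ≥0∞ := fun x => ∑ i, ‖fderiv ℝ φ x (EuclideanSpace.single i 1)‖ₑ ^ 2 with hq
  have hqm : Measurable q := Finset.measurable_fun_sum _ fun i _ =>
    ((hcd _).measurable.enorm.pow_const 2)
  have hkm : Measurable (D.indicator q) := hqm.indicator ho.measurableSet
  have hint : ∑ i, ∫⁻ x in D, ‖fderiv ℝ φ x (EuclideanSpace.single i 1)‖ₑ ^ 2 =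
      ∫⁻ x, D.indicator q x := by
    rw [lintegral_indicator ho.measurableSet, hq,
      lintegral_finsetSum _ fun i _ => ((hcd _).measurable.enorm.pow_const 2)]
  have hpt : ∀ x ∈ D, ‖φ x‖ₑ ^ 2 ≤
      2 * ‖φ (x - exitTime D (vertical y) x • vertical y)‖ₑ ^ 2 +
        2 * ENNReal.ofReal (2 * R) *
          ∫⁻ s in Set.Ioo 0 (2 * R), D.indicator q (x - s • vertical y) := by
    intro x hx
    have hle := exitTime_le_of_mem he hD hx
    have h1 := enorm_sq_le_along_line hφ x (-vertical y) (exitTime_mem ho he hD x).1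
    simp only [smul_neg, ← sub_eq_add_neg] at h1
    refine h1.trans (add_le_add le_rfl (mul_le_mul' (by gcongr) ?_))
    -- Before the exit time the segment lies in `D`, where the indicator is harmless; the interval
    -- is then enlarged to one independent of `x`.
    refine (setLIntegral_mono' measurableSet_Ioo fun s hs => ?_).trans
      (lintegral_mono_set (Set.Ioo_subset_Ioo_right hle))
    rw [Set.indicator_of_mem (sub_smul_mem_of_lt_exitTime hs.1.le hs.2)]
    exact enorm_fderiv_sq_le (by rw [norm_neg, he]) _
  have h1 : ∫⁻ x in D, ‖φ (x - exitTime D (vertical y) x • vertical y)‖ₑ ^ 2 ≤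
      ENNReal.ofReal (2 * R) * ∫⁻ x in frontier D, ‖φ x‖ₑ ^ 2
          ∂(Measure.euclideanHausdorffMeasure n) := by
    rw [← smul_eq_mul, ← lintegral_smul_measure,
      ← lintegral_map (f := fun x => ‖φ x‖ₑ ^ 2) (hcφ.measurable.enorm.pow_const 2) hb]
    exact lintegral_mono' (map_exitPoint_le y ho hD) le_rfl
  have h2 : ∫⁻ x in D, ∫⁻ s in Set.Ioo 0 (2 * R), D.indicator q (x - s • vertical y) ≤
      ENNReal.ofReal (2 * R) * ∫⁻ x, D.indicator q x := by
    rw [← lintegral_sub_smul_le hkm (vertical y)]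
    exact setLIntegral_le_lintegral _ _
  calc ∫⁻ x in D, ‖φ x‖ₑ ^ 2 ≤ _ := setLIntegral_mono' ho.measurableSet hpt
    _ = 2 * (∫⁻ x in D, ‖φ (x - exitTime D (vertical y) x • vertical y)‖ₑ ^ 2) +
        2 * ENNReal.ofReal (2 * R) *
          ∫⁻ x in D, ∫⁻ s in Set.Ioo 0 (2 * R), D.indicator q (x - s • vertical y) := by
      have hm : Measurable fun x => ‖φ (x - exitTime D (vertical y) x • vertical y)‖ₑ ^ 2 :=
        (hcφ.measurable.comp hb).enorm.pow_const 2
      have hm2 : Measurable fun x => ∫⁻ s in Set.Ioo 0 (2 * R),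
          D.indicator q (x - s • vertical y) := by
        have h : Measurable fun p : Eu d × ℝ => p.1 - p.2 • vertical y := by fun_prop
        exact (hkm.comp h).lintegral_prod_right'
      rw [lintegral_add_left (hm.const_mul 2), lintegral_const_mul _ hm,
        lintegral_const_mul _ hm2]
    _ ≤ 2 * (ENNReal.ofReal (2 * R) * ∫⁻ x in frontier D, ‖φ x‖ₑ ^ 2
          ∂(Measure.euclideanHausdorffMeasure n)) +
        2 * ENNReal.ofReal (2 * R) * (ENNReal.ofReal (2 * R) * ∫⁻ x, D.indicator q x) := by
      gcongr
    _ ≤ _ := by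
      rw [hint, mul_add]
      simp only [ENNReal.coe_add, ENNReal.coe_mul, ENNReal.coe_ofNat]
      change _ ≤ (2 * ENNReal.ofReal (2 * R) + 2 * ENNReal.ofReal (2 * R) * ENNReal.ofReal (2 * R))
        * _ + (2 * ENNReal.ofReal (2 * R) + 2 * ENNReal.ofReal (2 * R) * ENNReal.ofReal (2 * R)) * _
      rw [← mul_assoc, ← mul_assoc]
      gcongr
      · exact le_self_add
      · exact le_add_self

end Poincare

/-! ### The trace inequality for smooth functions -/

section Trace

variable {d n : ℕ} {D : Set (Eu d)}

theorem euclideanHausdorffMeasure_image_graph_le (y : Eu d ≃ₗᵢ[ℝ] WithLp 2 (Eu n × ℝ))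
    {h : Eu n → ℝ} {K : ℝ≥0} (hK : LipschitzWith K h) : ∃ C : ℝ≥0, ∀ A : Set (Eu n),
      Measure.euclideanHausdorffMeasure n
        ((fun z => y.symm (WithLp.toLp 2 (z, h z))) '' A) ≤ C * volume A := by
  obtain ⟨L, hL⟩ : ∃ L, LipschitzWith L (fun z => y.symm (WithLp.toLp 2 (z, h z))) :=
    ⟨_, y.symm.lipschitz.comp ((WithLp.prod_lipschitzWith_toLp 2 (Eu n) ℝ).comp
      (LipschitzWith.id.prodMk hK))⟩
  refine ⟨L ^ n, fun A => ?_⟩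
  rw [← EuclideanSpace.euclideanHausdorffMeasure_eq_volume n,
    Measure.euclideanHausdorffMeasure_def, Measure.euclideanHausdorffMeasure_def]
  simp only [Measure.smul_apply]
  rw [ENNReal.smul_def, ENNReal.smul_def, smul_eq_mul, smul_eq_mul, mul_left_comm]
  gcongr
  simpa using hL.hausdorffMeasure_image_le (d := (n : ℝ)) (by positivity) A

/-- Segments of length `δ` going up from the graph stay in `D`; averaging the one-dimensional
estimate over the endpoint replaces boundary values by values in `D`. The chart of radius `2δ`
leaves room for segments starting within `δ` of `P`. -/
theorem lintegral_enorm_sq_graph_le (ho : IsOpen D) (y : Eu d ≃ₗᵢ[ℝ] WithLp 2 (Eu n × ℝ))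
    {P : Eu d} {δ : ℝ} (hδ : 0 < δ) {h : Eu n → ℝ} {K : ℝ≥0} (hK : LipschitzWith K h)
    (h1 : Metric.ball P (2 * δ) ∩ D = Metric.ball P (2 * δ) ∩ {x | h (y x).fst < (y x).snd})
    (h2 : Metric.ball P (2 * δ) ∩ frontier D =
      Metric.ball P (2 * δ) ∩ {x | (y x).snd = h (y x).fst}) :
    ∃ C : ℝ≥0, ∀ φ : Eu d → ℂ, ContDiff ℝ (⊤ : ℕ∞) φ →
      ∫⁻ x in frontier D ∩ Metric.ball P δ, ‖φ x‖ₑ ^ 2 ∂(Measure.euclideanHausdorffMeasure n) ≤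
        C * ((∫⁻ x in D, ‖φ x‖ₑ ^ 2) +
          ∑ i, ∫⁻ x in D, ‖fderiv ℝ φ x (EuclideanSpace.single i 1)‖ₑ ^ 2) := by
  obtain ⟨C, hC⟩ := euclideanHausdorffMeasure_image_graph_le y hK
  have he := norm_vertical y
  set G : Eu n → Eu d := fun z => y.symm (WithLp.toLp 2 (z, h z)) with hG
  have hGc : Continuous G := by
    have := hK.continuous
    fun_prop
  set B : Set (Eu d) := frontier D ∩ Metric.ball P δ with hB
  have hsub : Metric.ball P δ ⊆ Metric.ball P (2 * δ) := Metric.ball_subset_ball (by linarith)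
  have hBgraph : ∀ b ∈ B, (y b).snd = h (y b).fst := fun b hb =>
    (h2.subset ⟨hsub hb.2, hb.1⟩).2
  have hmeas : (Measure.euclideanHausdorffMeasure n).restrict B ≤
      (C : ℝ≥0∞) • (volume : Measure (Eu n)).map G := by
    refine Measure.le_iff.2 fun A hA => ?_
    rw [Measure.restrict_apply hA, Measure.smul_apply, Measure.map_apply hGc.measurable hA]
    refine (measure_mono ?_).trans (hC (G ⁻¹' A))
    rintro b ⟨hbA, hbB⟩
    have hb : G (y b).fst = b := by
      rw [hG]
      simp only [← hBgraph b hbB]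
      exact y.symm_apply_apply b
    exact ⟨(y b).fst, by rwa [Set.mem_preimage, hb], hb⟩
  have hin : ∀ b ∈ B, ∀ t ∈ Set.Ioo 0 δ, b + t • vertical y ∈ D := by
    intro b hb t ht
    have h3 : b + t • vertical y ∈ Metric.ball P (2 * δ) := by
      rw [Metric.mem_ball]
      have h4 : dist (b + t • vertical y) b = t := by
        rw [dist_eq_norm, add_sub_cancel_left, norm_smul, he, mul_one, Real.norm_eq_abs,
          abs_of_pos ht.1]
      have h5 := dist_triangle (b + t • vertical y) b P
      have h6 : dist b P < δ := hb.2
      linarith [ht.2]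
    refine (h1.symm.subset ⟨h3, ?_⟩).2
    obtain ⟨e1, e2⟩ := apply_add_smul_vertical y b t
    simp only [Set.mem_ofPred_eq, e1, e2, hBgraph b hb]
    linarith [ht.1]
  set δ' : ℝ≥0 := δ.toNNReal with hδ'
  have hδ0 : δ' ≠ 0 := by simpa [hδ'] using hδ
  -- `δ⁻¹` comes from the averaging, `C` from comparing surface and Lebesgue measure, and `2 + 2δ²`
  -- dominates both weights in `m`.
  refine ⟨δ'⁻¹ * (C * (2 + 2 * δ' * δ')), fun φ hφ => ?_⟩
  have hcφ : Continuous φ := hφ.continuous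
  have hcd : ∀ v, Continuous fun x => fderiv ℝ φ x v := fun v =>
    (hφ.continuous_fderiv (by simp)).clm_apply continuous_const
  set q : Eu d → ℝ≥0∞ := fun x => ∑ i, ‖fderiv ℝ φ x (EuclideanSpace.single i 1)‖ₑ ^ 2 with hq
  have hqm : Measurable q := Finset.measurable_fun_sum _ fun i _ =>
    ((hcd _).measurable.enorm.pow_const 2)
  have hφm : Measurable fun x => ‖φ x‖ₑ ^ 2 := hcφ.measurable.enorm.pow_const 2
  set m : Eu d → ℝ≥0∞ := D.indicator fun x => 2 * ‖φ x‖ₑ ^ 2 + 2 * δ' * δ' * q x with hm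
  have hmm : Measurable m :=
    ((hφm.const_mul 2).add (hqm.const_mul _)).indicator ho.measurableSet
  have hmint : ∫⁻ x, m x = 2 * (∫⁻ x in D, ‖φ x‖ₑ ^ 2) + 2 * δ' * δ' *
      ∑ i, ∫⁻ x in D, ‖fderiv ℝ φ x (EuclideanSpace.single i 1)‖ₑ ^ 2 := by
    rw [hm, lintegral_indicator ho.measurableSet, lintegral_add_left (hφm.const_mul 2),
      lintegral_const_mul _ hφm, lintegral_const_mul _ hqm, hq,
      lintegral_finsetSum _ fun i _ => ((hcd _).measurable.enorm.pow_const 2)]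
  have hline : Measurable fun p : Eu d × ℝ => p.1 + p.2 • vertical y := by fun_prop
  have hmline : Measurable fun p : Eu d × ℝ => m (p.1 + p.2 • vertical y) := hmm.comp hline
  have hpt : ∀ b ∈ B, ‖φ b‖ₑ ^ 2 * δ' ≤ ∫⁻ t : ℝ, m (b + t • vertical y) := by
    intro b hb
    have hI : ∫⁻ _ in Set.Ioo 0 δ, ‖φ b‖ₑ ^ 2 = ‖φ b‖ₑ ^ 2 * δ' := by
      rw [setLIntegral_const, Real.volume_Ioo, sub_zero]; rfl
    -- The gradient term is constant in the endpoint `t`, so integrating over `t` contributes a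
    -- second factor `δ`.
    have hconst : ∫⁻ _ in Set.Ioo 0 δ, (2 * (δ' : ℝ≥0∞) * ∫⁻ s in Set.Ioo 0 δ,
        q (b + s • vertical y)) = ∫⁻ t in Set.Ioo 0 δ, 2 * δ' * δ' * q (b + t • vertical y) := by
      rw [setLIntegral_const, Real.volume_Ioo, sub_zero, lintegral_const_mul]
      · change _ * (δ' : ℝ≥0∞) = _
        ring
      · exact hqm.comp (hline.comp measurable_prodMk_left)
    calc ‖φ b‖ₑ ^ 2 * δ' = ∫⁻ _ in Set.Ioo 0 δ, ‖φ b‖ₑ ^ 2 := hI.symm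
      _ ≤ ∫⁻ t in Set.Ioo 0 δ, (2 * ‖φ (b + t • vertical y)‖ₑ ^ 2 + 2 * (δ' : ℝ≥0∞) *
          ∫⁻ s in Set.Ioo 0 δ, q (b + s • vertical y)) := by
        refine setLIntegral_mono' measurableSet_Ioo fun t ht => ?_
        refine (enorm_sq_le_along_line hφ b (vertical y) ht.1.le).trans ?_
        have hle : ENNReal.ofReal t ≤ δ' := ENNReal.ofReal_le_ofReal ht.2.le
        refine add_le_add le_rfl (mul_le_mul' (by gcongr) ?_)
        refine (lintegral_mono fun s => enorm_fderiv_sq_le he _).trans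
          (lintegral_mono_set (Set.Ioo_subset_Ioo_right ht.2.le))
      _ = ∫⁻ t in Set.Ioo 0 δ, (2 * ‖φ (b + t • vertical y)‖ₑ ^ 2 +
          2 * δ' * δ' * q (b + t • vertical y)) := by
        have hmb : Measurable fun t : ℝ => 2 * ‖φ (b + t • vertical y)‖ₑ ^ 2 :=
          (hφm.comp (hline.comp measurable_prodMk_left)).const_mul 2
        rw [lintegral_add_left hmb, lintegral_add_left hmb, hconst]
      _ = ∫⁻ t in Set.Ioo 0 δ, m (b + t • vertical y) :=
        setLIntegral_congr_fun measurableSet_Ioo fun t ht => by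
          rw [hm, Set.indicator_of_mem (hin b hb t ht)]
      _ ≤ _ := setLIntegral_le_lintegral _ _
  -- In the coordinates `y` this is the shear `(z, t) ↦ (z, t + h z)`, which preserves volume: for
  -- each `z`, translation in `t` removes `h`.
  have hshear : ∫⁻ z, ∫⁻ t : ℝ, m (G z + t • vertical y) = ∫⁻ x, m x := by
    set ψ : Eu n × ℝ → Eu d := fun p => y.symm (WithLp.toLp 2 p) with hψ
    have hψm : Measurable ψ := by
      have : Continuous ψ := by fun_prop
      exact this.measurable
    have e1 : ∀ z t, G z + t • vertical y = ψ (z, t + h z) := by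
      intro z t
      rw [hG, hψ, vertical, ← map_smul, ← map_add, ← WithLp.toLp_smul, ← WithLp.toLp_add]
      simp [add_comm]
    simp_rw [e1]
    have e2 : ∀ z, ∫⁻ t, m (ψ (z, t + h z)) = ∫⁻ t, m (ψ (z, t)) := fun z =>
      lintegral_add_right_eq_self (fun t => m (ψ (z, t))) (h z)
    simp_rw [e2]
    rw [← lintegral_prod (fun p => m (ψ p)) (hmm.comp hψm).aemeasurable,
      ← (measurePreserving_coords y).lintegral_comp (f := fun p => m (ψ p)) (hmm.comp hψm)]
    simp [hψ]
  have hBm : MeasurableSet B := isClosed_frontier.measurableSet.inter measurableSet_ball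
  have hinner : Measurable fun b => ∫⁻ t : ℝ, m (b + t • vertical y) :=
    hmline.lintegral_prod_right'
  have key : (∫⁻ x in B, ‖φ x‖ₑ ^ 2 ∂(Measure.euclideanHausdorffMeasure n)) * δ' ≤
      C * ∫⁻ x, m x := by
    rw [← lintegral_mul_const _ hφm]
    calc _ ≤ ∫⁻ b in B, (∫⁻ t : ℝ, m (b + t • vertical y)) ∂(Measure.euclideanHausdorffMeasure n) :=
          setLIntegral_mono' hBm hpt
      _ ≤ ∫⁻ b, (∫⁻ t : ℝ, m (b + t • vertical y)) ∂((C : ℝ≥0∞) • (volume : Measure (Eu n)).map G) :=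
          lintegral_mono' hmeas le_rfl
      _ = C * ∫⁻ x, m x := by
          rw [lintegral_smul_measure, lintegral_map hinner hGc.measurable, hshear, smul_eq_mul]
  have hδE : (δ' : ℝ≥0∞) ≠ 0 := by exact_mod_cast hδ0
  rw [← ENNReal.le_div_iff_mul_le (Or.inl hδE) (Or.inl ENNReal.coe_ne_top)] at key
  refine key.trans ?_
  rw [hmint, ENNReal.div_eq_inv_mul, ENNReal.coe_mul, ENNReal.coe_inv hδ0, ENNReal.coe_mul C,
    mul_assoc (δ' : ℝ≥0∞)⁻¹, mul_assoc (C : ℝ≥0∞)]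
  gcongr
  simp only [ENNReal.coe_add, ENNReal.coe_mul, ENNReal.coe_ofNat]
  rw [mul_add]
  gcongr
  · exact le_self_add
  · exact le_add_self

/-- Such an estimate passes to subsets and finite unions, so compactness of the boundary glues the
local ones. -/
theorem lintegral_frontier_enorm_sq_le (hD : IsBoundedLipschitzDomain D) :
    ∃ C : ℝ≥0, ∀ φ : Eu d → ℂ, ContDiff ℝ (⊤ : ℕ∞) φ →
      ∫⁻ x, ‖φ x‖ₑ ^ 2 ∂(surfaceMeasure D) ≤
        C * ((∫⁻ x in D, ‖φ x‖ₑ ^ 2) +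
          ∑ i, ∫⁻ x in D, ‖fderiv ℝ φ x (EuclideanSpace.single i 1)‖ₑ ^ 2) := by
  have hc : IsCompact (frontier D) := hD.isBounded.isCompact_closure.of_isClosed_subset
    isClosed_frontier frontier_subset_closure
  refine hc.induction_on (p := fun S => ∃ C : ℝ≥0, ∀ φ : Eu d → ℂ, ContDiff ℝ (⊤ : ℕ∞) φ →
      ∫⁻ x in S, ‖φ x‖ₑ ^ 2 ∂(Measure.euclideanHausdorffMeasure (d - 1)) ≤
        C * ((∫⁻ x in D, ‖φ x‖ₑ ^ 2) +
          ∑ i, ∫⁻ x in D, ‖fderiv ℝ φ x (EuclideanSpace.single i 1)‖ₑ ^ 2)) ?_ ?_ ?_ ?_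
  · exact ⟨0, fun φ _ => by simp⟩
  · rintro s t hst ⟨C, hC⟩
    exact ⟨C, fun φ hφ => (lintegral_mono_set hst).trans (hC φ hφ)⟩
  · rintro s t ⟨C, hC⟩ ⟨C', hC'⟩
    refine ⟨C + C', fun φ hφ => (lintegral_union_le _ s t).trans ?_⟩
    rw [ENNReal.coe_add, add_mul]
    exact add_le_add (hC φ hφ) (hC' φ hφ)
  · intro P hP
    obtain ⟨y, ρ, h, K, hρ, hK, h1, h2⟩ := hD.graph P hP
    have e : ρ = 2 * (ρ / 2) := by ring
    rw [e] at h1 h2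
    exact ⟨frontier D ∩ Metric.ball P (ρ / 2),
      inter_mem_nhdsWithin _ (Metric.ball_mem_nhds P (by positivity)),
      lintegral_enorm_sq_graph_le hD.isOpen y (by positivity) hK h1 h2⟩

end Trace

end Calderon

namespace Calderon

/-! ### Passage from smooth functions to `H¹(D)`; completeness -/

section Sobolev

variable {d : ℕ} {D : Set (Eu d)}

/-- Smooth trace pairs only prescribe the function, while the norm of `H¹(D)` sees weak derivatives.
Integration by parts shows that weak and classical derivatives agree against every test function. -/
theorem partialDeriv_ae_eq_fderiv (ho : IsOpen D) (u : H1 D) {φ : Eu d → ℂ}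
    (hφ : ContDiff ℝ (⊤ : ℕ∞) φ) (hu : fn u =ᵐ[volume.restrict D] φ) (i : Fin d) :
    partialDeriv u i =ᵐ[volume.restrict D]
      fun x => fderiv ℝ φ x (EuclideanSpace.single i 1) := by
  have hcd : Continuous fun x => fderiv ℝ φ x (EuclideanSpace.single i 1) :=
    (hφ.continuous_fderiv (by simp)).clm_apply continuous_const
  have hloc : LocallyIntegrable (partialDeriv u i) (volume.restrict D) :=
    (Lp.memLp (partialDeriv u i)).locallyIntegrable (by norm_num)
  have h := ho.ae_eq_zero_of_integral_contDiff_smul_eq_zero (μ := volume)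
    (f := fun x => partialDeriv u i x - fderiv ℝ φ x (EuclideanSpace.single i 1)) ?_ ?_
  · filter_upwards [(ae_restrict_iff' ho.measurableSet).2 h] with x hx
    exact sub_eq_zero.1 hx
  · refine LocallyIntegrableOn.sub ?_ (hcd.locallyIntegrable.locallyIntegrableOn D)
    exact locallyIntegrableOn_of_locallyIntegrable_restrict hloc
  · intro g hg hgc hgs
    have hT : IsTestFunction D g := ⟨hg, hgc, hgs⟩
    have hgd : Differentiable ℝ g := hg.differentiable (by simp)
    have hgcd : Continuous fun x => fderiv ℝ g x (EuclideanSpace.single i 1) :=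
      (hg.continuous_fderiv (by simp)).clm_apply continuous_const
    have hz : ∀ x, x ∉ D → g x = 0 := fun x hx => image_eq_zero_of_notMem_tsupport
      fun h => hx (hgs h)
    have hz' : ∀ x, x ∉ D → fderiv ℝ g x (EuclideanSpace.single i 1) = 0 := fun x hx => by
      rw [fderiv_of_notMem_tsupport (𝕜 := ℝ) fun h => hx (hgs h)]; rfl
    have hparts := integral_smul_fderiv_eq_neg_fderiv_smul_of_integrable (μ := volume)
      (f := g) (g := φ) (v := EuclideanSpace.single i (1 : ℝ))
      ((hgcd.smul hφ.continuous).integrable_of_hasCompactSupport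
        ((hgc.fderiv_apply ℝ _).smul_right))
      ((hg.continuous.smul hcd).integrable_of_hasCompactSupport hgc.smul_right)
      ((hg.continuous.smul hφ.continuous).integrable_of_hasCompactSupport hgc.smul_right)
      (fun x _ => hgd x) (fun x _ => hφ.differentiable (by simp) x)
    have hw := u.2 i g hT
    have e1 : (∫ x in D, fderiv ℝ g x (EuclideanSpace.single i 1) • fn u x) =
        ∫ x, fderiv ℝ g x (EuclideanSpace.single i 1) • φ x := by
      rw [← setIntegral_eq_integral_of_forall_compl_eq_zero (s := D)
        (f := fun x => fderiv ℝ g x (EuclideanSpace.single i 1) • φ x)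
        fun x hx => by rw [hz' x hx, zero_smul]]
      refine integral_congr_ae ?_
      filter_upwards [hu] with x hx
      rw [hx]
    have e2 : ∫ x, g x • (partialDeriv u i x - fderiv ℝ φ x (EuclideanSpace.single i 1)) =
        (∫ x in D, g x • partialDeriv u i x) -
          ∫ x, g x • fderiv ℝ φ x (EuclideanSpace.single i 1) := by
      rw [← setIntegral_eq_integral_of_forall_compl_eq_zero (s := D)
        (f := fun x => g x • (partialDeriv u i x -
          fderiv ℝ φ x (EuclideanSpace.single i 1))) fun x hx => by rw [hz x hx, zero_smul],
        ← setIntegral_eq_integral_of_forall_compl_eq_zero (s := D)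
        (f := fun x => g x • fderiv ℝ φ x (EuclideanSpace.single i 1))
        fun x hx => by rw [hz x hx, zero_smul], ← integral_sub (hT.integrable_smul _)]
      · simp_rw [smul_sub]
      · exact ((hg.continuous.smul hcd).integrable_of_hasCompactSupport hgc.smul_right).restrict
    rw [e2, hparts, ← e1, hw]
    simp

theorem norm_sq_eq (u : H1 D) : ‖u‖ ^ 2 = ‖fn u‖ ^ 2 + ∑ i, ‖partialDeriv u i‖ ^ 2 := by
  rw [Submodule.coe_norm, WithLp.prod_norm_sq_eq_of_L2, PiLp.norm_sq_eq_of_L2]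

theorem lintegral_enorm_sq_eq {α : Type*} [MeasurableSpace α] {μ : Measure α} (f : Lp ℂ 2 μ)
    {φ : α → ℂ} (h : f =ᵐ[μ] φ) : ∫⁻ x, ‖φ x‖ₑ ^ 2 ∂μ = ENNReal.ofReal (‖f‖ ^ 2) := by
  rw [← Real.enorm_eq_ofReal (by positivity), enorm_pow, enorm_norm, Lp.enorm_def,
    eLpNorm_congr_ae h]
  have := eLpNorm_nnreal_pow_eq_lintegral (f := φ) (p := 2) (μ := μ) two_ne_zero
  simpa using this.symm

theorem continuous_fn : Continuous fun u : H1 D => fn u := by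
  have : Continuous fun p : L2Jet D => p.fst := by fun_prop
  exact this.comp continuous_subtype_val

theorem continuous_partialDeriv (i : Fin d) : Continuous fun u : H1 D => partialDeriv u i := by
  have : Continuous fun p : L2Jet D => p.snd i := by fun_prop
  exact this.comp continuous_subtype_val

/-- The trace graph is the closure of the smooth pairs, so a closed condition need only be checked
on these. -/
theorem HasTrace.mem_of_isClosed {S : Set (H1 D × L2Boundary D)} (hS : IsClosed S)
    (h : ∀ (u : H1 D) (f : L2Boundary D) (φ : Eu d → ℂ), ContDiff ℝ (⊤ : ℕ∞) φ →
      fn u =ᵐ[volume.restrict D] φ → f =ᵐ[surfaceMeasure D] φ → (u, f) ∈ S)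
    {u : H1 D} {f : L2Boundary D} (huf : HasTrace u f) : (u, f) ∈ S := by
  have h1 : (u, f) ∈ closure (smoothTracePairs D : Set (H1 D × L2Boundary D)) := by
    rw [← Submodule.topologicalClosure_coe]
    exact huf
  have h2 : (smoothTracePairs D : Set (H1 D × L2Boundary D)) ⊆ S := by
    rintro ⟨u, f⟩ ⟨φ, hφ, h3, h4⟩
    exact h u f φ hφ h3 h4
  exact hS.closure_subset_iff.2 h2 h1

theorem exists_norm_le_of_hasTrace (hD : IsBoundedLipschitzDomain D) :
    ∃ C : ℝ≥0, ∀ (u : H1 D) (f : L2Boundary D), HasTrace u f → ‖f‖ ^ 2 ≤ C * ‖u‖ ^ 2 := by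
  obtain ⟨C, hC⟩ := lintegral_frontier_enorm_sq_le hD
  refine ⟨C, fun u f h => ?_⟩
  have hcl : IsClosed {p : H1 D × L2Boundary D | ‖p.2‖ ^ 2 ≤ C * ‖p.1‖ ^ 2} :=
    isClosed_le (by fun_prop) (by fun_prop)
  refine HasTrace.mem_of_isClosed hcl (fun u f φ hφ h1 h2 => ?_) h
  have := hC φ hφ
  have hsum : ∀ i, ∫⁻ x in D, ‖fderiv ℝ φ x (EuclideanSpace.single i 1)‖ₑ ^ 2 =
      ENNReal.ofReal (‖partialDeriv u i‖ ^ 2) := fun i =>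
    lintegral_enorm_sq_eq _ (partialDeriv_ae_eq_fderiv hD.isOpen u hφ h1 i)
  rw [lintegral_enorm_sq_eq f h2, lintegral_enorm_sq_eq (fn u) h1] at this
  simp_rw [hsum] at this
  rw [← ENNReal.ofReal_sum_of_nonneg fun i _ => by positivity,
    ← ENNReal.ofReal_add (by positivity) (Finset.sum_nonneg fun i _ => by positivity),
    ← norm_sq_eq, ← ENNReal.ofReal_coe_nnreal, ← ENNReal.ofReal_mul C.coe_nonneg] at this
  exact (ENNReal.ofReal_le_ofReal_iff (by positivity)).1 this

theorem frontier_nonempty (hd : 2 ≤ d) (hD : IsBoundedLipschitzDomain D) :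
    (frontier D).Nonempty := by
  rw [Set.nonempty_iff_ne_empty, Ne, ← isClopen_iff_frontier_eq_empty]
  intro h
  have : Nontrivial (Eu d) := by
    have : Nonempty (Fin d) := ⟨⟨0, by omega⟩⟩
    infer_instance
  rcases isClopen_iff.1 h with h | h
  · exact hD.isConnected.nonempty.ne_empty h
  · have := hD.isBounded
    rw [h] at this
    exact NormedSpace.unbounded_univ ℝ (Eu d) this

theorem exists_norm_fn_le (hd : 2 ≤ d) (hD : IsBoundedLipschitzDomain D) :
    ∃ C : ℝ≥0, ∀ (u : H1 D) (f : L2Boundary D), HasTrace u f →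
      ‖fn u‖ ^ 2 ≤ C * (‖f‖ ^ 2 + ∑ i, ‖partialDeriv u i‖ ^ 2) := by
  obtain ⟨P, hP⟩ := frontier_nonempty hd hD
  -- Only the isometry of a chart is kept: any slicing direction would do.
  obtain ⟨y, -⟩ := hD.graph P hP
  obtain ⟨R, hR⟩ := hD.isBounded.subset_ball 0
  obtain ⟨C, hC⟩ := lintegral_enorm_sq_le_frontier y hD.isOpen hR
  refine ⟨C, fun u f h => ?_⟩
  set S := {p : H1 D × L2Boundary D | ‖fn p.1‖ ^ 2 ≤
    C * (‖p.2‖ ^ 2 + ∑ i, ‖partialDeriv p.1 i‖ ^ 2)} with hS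
  have hcl : IsClosed S := by
    have h1 : Continuous fun p : H1 D × L2Boundary D => fn p.1 :=
      continuous_fn.comp continuous_fst
    have h2 : ∀ i, Continuous fun p : H1 D × L2Boundary D => partialDeriv p.1 i := fun i =>
      (continuous_partialDeriv i).comp continuous_fst
    exact isClosed_le (by fun_prop) (by fun_prop)
  refine HasTrace.mem_of_isClosed hcl (fun u f φ hφ h1 h2 => ?_) h
  have := hC φ hφ
  have hsum : ∀ i, ∫⁻ x in D, ‖fderiv ℝ φ x (EuclideanSpace.single i 1)‖ₑ ^ 2 =
      ENNReal.ofReal (‖partialDeriv u i‖ ^ 2) := fun i =>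
    lintegral_enorm_sq_eq _ (partialDeriv_ae_eq_fderiv hD.isOpen u hφ h1 i)
  have hsf : ∫⁻ x in frontier D, ‖φ x‖ₑ ^ 2 ∂(Measure.euclideanHausdorffMeasure (d - 1)) =
      ENNReal.ofReal (‖f‖ ^ 2) := lintegral_enorm_sq_eq f h2
  rw [hsf, lintegral_enorm_sq_eq (fn u) h1] at this
  simp_rw [hsum] at this
  rw [← ENNReal.ofReal_sum_of_nonneg fun i _ => by positivity,
    ← ENNReal.ofReal_add (by positivity) (Finset.sum_nonneg fun i _ => by positivity),
    ← ENNReal.ofReal_coe_nnreal, ← ENNReal.ofReal_mul C.coe_nonneg] at this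
  exact (ENNReal.ofReal_le_ofReal_iff (mul_nonneg C.coe_nonneg
    (add_nonneg (by positivity) (Finset.sum_nonneg fun i _ => by positivity)))).1 this

theorem continuous_integral_smul {ψ : Eu d → ℝ} (hψ : MemLp ψ 2 (volume.restrict D)) :
    Continuous fun u : L2Domain D => ∫ x in D, ψ x • u x := by
  have hc : MemLp (fun x => (ψ x : ℂ)) 2 (volume.restrict D) := hψ.ofReal
  have h : ∀ u : L2Domain D, ∫ x in D, ψ x • u x = ⟪hc.toLp _, u⟫_ℂ := by
    intro u
    rw [L2.inner_def]
    refine integral_congr_ae ?_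
    filter_upwards [hc.coeFn_toLp] with x hx
    rw [hx, RCLike.inner_apply, Complex.conj_ofReal, mul_comm, Complex.real_smul]
  simp_rw [h]
  fun_prop

/-- Each defining identity equates two continuous functionals, since integration against a test
function or its derivative is an `L²` pairing. -/
theorem isClosed_H1 : IsClosed (H1 D : Set (L2Jet D)) := by
  have h : (H1 D : Set (L2Jet D)) = ⋂ i, ⋂ φ : {φ : Eu d → ℝ // IsTestFunction D φ},
      {p : L2Jet D | ∫ x in D, fderiv ℝ φ.1 x (EuclideanSpace.single i 1) • p.fst x =
        - ∫ x in D, φ.1 x • p.snd i x} := by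
    ext p
    simp only [Set.mem_iInter, Subtype.forall]
    rfl
  rw [h]
  refine isClosed_iInter fun i => isClosed_iInter fun φ => ?_
  have h1 : MemLp φ.1 2 ((volume : Measure (Eu d)).restrict D) :=
    (φ.2.smooth.continuous.memLp_of_hasCompactSupport φ.2.compact).restrict D
  have h2 : MemLp (fun x => fderiv ℝ φ.1 x (EuclideanSpace.single i 1)) 2
      ((volume : Measure (Eu d)).restrict D) :=
    ((((φ.2.smooth.continuous_fderiv (by simp)).clm_apply
      continuous_const).memLp_of_hasCompactSupport (φ.2.compact.fderiv_apply ℝ _)).restrict D)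
  refine isClosed_eq ((continuous_integral_smul h2).comp ?_)
    ((continuous_integral_smul h1).comp ?_).neg
  · fun_prop
  · fun_prop

instance : CompleteSpace (H1 D) := isClosed_H1.completeSpace_coe

end Sobolev

/-! ### Complex conjugation, linking the bilinear energy form to the sesquilinear inner product -/

section Conjugation

/-- Pointwise complex conjugation on `L²`. -/
noncomputable def conjLp {α : Type*} [MeasurableSpace α] (μ : Measure α) :
    Lp ℂ 2 μ →L[ℝ] Lp ℂ 2 μ :=
  ContinuousLinearMap.compLpL 2 μ (Complex.conjCLE : ℂ →L[ℝ] ℂ)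

theorem coeFn_conjLp {α : Type*} [MeasurableSpace α] {μ : Measure α} (f : Lp ℂ 2 μ) :
    conjLp μ f =ᵐ[μ] fun x => conj (f x) := by
  filter_upwards [ContinuousLinearMap.coeFn_compLpL (Complex.conjCLE : ℂ →L[ℝ] ℂ) f] with x hx
  exact hx

theorem conjLp_conjLp {α : Type*} [MeasurableSpace α] {μ : Measure α} (f : Lp ℂ 2 μ) :
    conjLp μ (conjLp μ f) = f := by
  refine Lp.ext ?_
  filter_upwards [coeFn_conjLp (conjLp μ f), coeFn_conjLp f] with x h1 h2
  rw [h1, h2, Complex.conj_conj]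

theorem norm_conjLp {α : Type*} [MeasurableSpace α] {μ : Measure α} (f : Lp ℂ 2 μ) :
    ‖conjLp μ f‖ = ‖f‖ := by
  refine le_antisymm (Lp.norm_le_norm_of_ae_le ?_) (Lp.norm_le_norm_of_ae_le ?_) <;>
  · filter_upwards [coeFn_conjLp f] with x h
    rw [h, RCLike.norm_conj]

variable {d : ℕ} {D : Set (Eu d)}

/-- Test functions are real valued, so conjugation passes through both integrals. -/
theorem IsWeakPartial.conjLp {i : Fin d} {u g : L2Domain D} (h : IsWeakPartial D i u g) :
    IsWeakPartial D i (conjLp _ u) (conjLp _ g) := by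
  intro φ hφ
  have key : ∀ (ψ : Eu d → ℝ) (v : L2Domain D),
      ∫ x in D, ψ x • Calderon.conjLp _ v x = conj (∫ x in D, ψ x • v x) := by
    intro ψ v
    rw [← integral_conj]
    refine integral_congr_ae ?_
    filter_upwards [coeFn_conjLp v] with x hx
    simp [hx]
  rw [key, key, h φ hφ, map_neg]

/-- Pointwise complex conjugation on `H¹(D)`. -/
noncomputable def conjH1 (u : H1 D) : H1 D :=
  ⟨WithLp.toLp 2 (conjLp _ (fn u), WithLp.toLp 2 fun i => conjLp _ (partialDeriv u i)),
    fun i => (u.2 i).conjLp⟩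

theorem fn_conjH1 (u : H1 D) : fn (conjH1 u) = conjLp _ (fn u) := rfl

theorem partialDeriv_conjH1 (u : H1 D) (i : Fin d) :
    partialDeriv (conjH1 u) i = conjLp _ (partialDeriv u i) := rfl

theorem H1.ext {u v : H1 D} (h1 : fn u = fn v) (h2 : ∀ i, partialDeriv u i = partialDeriv v i) :
    u = v :=
  Subtype.ext (WithLp.ofLp_injective 2 (Prod.ext h1 (PiLp.ext h2)))

theorem conjH1_conjH1 (u : H1 D) : conjH1 (conjH1 u) = u := by
  refine H1.ext ?_ fun i => ?_
  · rw [fn_conjH1, fn_conjH1, conjLp_conjLp]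
  · rw [partialDeriv_conjH1, partialDeriv_conjH1, conjLp_conjLp]

theorem norm_conjH1 (u : H1 D) : ‖conjH1 u‖ = ‖u‖ := by
  rw [← sq_eq_sq₀ (norm_nonneg _) (norm_nonneg _), norm_sq_eq, norm_sq_eq, fn_conjH1, norm_conjLp]
  simp_rw [partialDeriv_conjH1, norm_conjLp]

theorem continuous_conjH1 : Continuous (conjH1 : H1 D → H1 D) := by
  have h1 := continuous_fn (D := D)
  have h2 := fun i => continuous_partialDeriv (D := D) i
  refine Continuous.subtype_mk ?_ _
  fun_prop

theorem HasTrace.conj {u : H1 D} {f : L2Boundary D} (h : HasTrace u f) :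
    HasTrace (conjH1 u) (conjLp _ f) := by
  have hc : Continuous fun p : H1 D × L2Boundary D => (conjH1 p.1, conjLp _ p.2) :=
    (continuous_conjH1.comp continuous_fst).prodMk
      ((conjLp _).continuous.comp continuous_snd)
  have hcl : IsClosed ((fun p : H1 D × L2Boundary D => (conjH1 p.1, conjLp _ p.2)) ⁻¹'
      (traceGraph D : Set (H1 D × L2Boundary D))) :=
    (Submodule.isClosed_topologicalClosure _).preimage hc
  refine HasTrace.mem_of_isClosed hcl (fun u f φ hφ h1 h2 => ?_) h
  refine Submodule.le_topologicalClosure _ ⟨fun x => conj (φ x), Complex.conjCLE.contDiff.comp hφ, ?_, ?_⟩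
  · filter_upwards [coeFn_conjLp (fn u), h1] with x hx hx'
    rw [fn_conjH1, hx, hx']
  · filter_upwards [coeFn_conjLp f, h2] with x hx hx'
    exact hx.trans (by rw [hx'])

end Conjugation

end Calderon

namespace Calderon

/-! ### The Dirichlet problem and the Dirichlet-to-Neumann form -/

section Dirichlet

variable {d : ℕ} {D : Set (Eu d)} {γ : Eu d → ℝ}

theorem IsConductivity.ae_le_supNorm (hγ : IsConductivity D γ) :
    ∀ᵐ x ∂(volume.restrict D), γ x ≤ supNorm D γ := by
  filter_upwards [ae_le_eLpNormEssSup (f := γ) (μ := volume.restrict D)] with x hx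
  rw [← eLpNorm_exponent_top] at hx
  have := ENNReal.toReal_mono hγ.memLp_top.2.ne hx
  exact (le_abs_self _).trans (by simpa [supNorm] using this)

theorem IsConductivity.memLp_sqrt (hγ : IsConductivity D γ) :
    MemLp (fun x => ((√(γ x) : ℝ) : ℂ)) ∞ (volume.restrict D) := by
  have h1 : AEStronglyMeasurable (fun x => ((√(γ x) : ℝ) : ℂ)) (volume.restrict D) :=
    (Complex.continuous_ofReal.comp Real.continuous_sqrt).comp_aestronglyMeasurable
      hγ.memLp_top.1
  refine memLp_top_of_bound h1 (√(supNorm D γ)) ?_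
  filter_upwards [hγ.ae_le_supNorm] with x hx
  rw [Complex.norm_real, Real.norm_eq_abs, abs_of_nonneg (Real.sqrt_nonneg _)]
  exact Real.sqrt_le_sqrt hx

/-- Multiplication by `√γ` on `L²(D)`. -/
noncomputable def mulSqrt (hγ : IsConductivity D γ) : L2Domain D →L[ℂ] L2Domain D :=
  (ContinuousLinearMap.mul ℂ ℂ).holderL (volume.restrict D) ∞ 2 2 (hγ.memLp_sqrt.toLp _)

theorem coeFn_mulSqrt (hγ : IsConductivity D γ) (f : L2Domain D) :
    mulSqrt hγ f =ᵐ[volume.restrict D] fun x => ((√(γ x) : ℝ) : ℂ) * f x := by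
  have h := (ContinuousLinearMap.mul ℂ ℂ).coeFn_holder (r := 2) (hγ.memLp_sqrt.toLp _) f
  filter_upwards [h, hγ.memLp_sqrt.coeFn_toLp] with x h1 h2
  rw [← h2]
  exact h1

/-- The conjugate on `f` cancels the one in the inner product; positivity of `γ` gives `√γ √γ = γ`.
-/
theorem inner_mulSqrt_conjLp (hγ : IsConductivity D γ) (f g : L2Domain D) :
    Integrable (fun x => (γ x : ℂ) * (f x * g x)) (volume.restrict D) ∧
    ⟪mulSqrt hγ (conjLp _ f), mulSqrt hγ g⟫_ℂ = ∫ x in D, (γ x : ℂ) * (f x * g x) := by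
  have h : (fun x => ⟪mulSqrt hγ (conjLp _ f) x, mulSqrt hγ g x⟫_ℂ) =ᵐ[volume.restrict D]
      fun x => (γ x : ℂ) * (f x * g x) := by
    obtain ⟨γ₀, h0, hlb⟩ := hγ.lower_bound
    filter_upwards [coeFn_mulSqrt hγ (conjLp _ f), coeFn_mulSqrt hγ g, coeFn_conjLp f, hlb]
      with x h1 h2 h3 h4
    have h5 : ((√(γ x) : ℝ) : ℂ) * ((√(γ x) : ℝ) : ℂ) = (γ x : ℂ) := by
      rw [← Complex.ofReal_mul, Real.mul_self_sqrt (h0.le.trans h4)]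
    rw [h1, h2, h3, RCLike.inner_apply, map_mul, Complex.conj_conj, Complex.conj_ofReal, ← h5]
    ring
  refine ⟨(L2.integrable_inner _ _).congr h, ?_⟩
  rw [L2.inner_def]
  exact integral_congr_ae h

theorem norm_mulSqrt_sq_le (hγ : IsConductivity D γ) (f : L2Domain D) :
    ‖mulSqrt hγ f‖ ^ 2 ≤ supNorm D γ * ‖f‖ ^ 2 := by
  have h : ‖mulSqrt hγ f‖ ≤ ‖((√(supNorm D γ) : ℝ) : ℂ) • f‖ := by
    refine Lp.norm_le_norm_of_ae_le ?_
    filter_upwards [coeFn_mulSqrt hγ f, Lp.coeFn_smul ((√(supNorm D γ) : ℝ) : ℂ) f,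
      hγ.ae_le_supNorm] with x h1 h2 h3
    rw [h1, h2, Pi.smul_apply, smul_eq_mul, norm_mul, norm_mul, Complex.norm_real,
      Complex.norm_real, Real.norm_eq_abs, Real.norm_eq_abs, abs_of_nonneg (Real.sqrt_nonneg _),
      abs_of_nonneg (Real.sqrt_nonneg _)]
    gcongr
  rw [norm_smul, Complex.norm_real, Real.norm_eq_abs, abs_of_nonneg (Real.sqrt_nonneg _)] at h
  calc _ ≤ _ := pow_le_pow_left₀ (norm_nonneg _) h 2
    _ = _ := by rw [mul_pow, Real.sq_sqrt (show 0 ≤ supNorm D γ from ENNReal.toReal_nonneg)]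

theorem exists_norm_sq_le_norm_mulSqrt_sq (hγ : IsConductivity D γ) :
    ∃ c : ℝ, 0 < c ∧ ∀ f : L2Domain D, c * ‖f‖ ^ 2 ≤ ‖mulSqrt hγ f‖ ^ 2 := by
  obtain ⟨γ₀, h0, hlb⟩ := hγ.lower_bound
  refine ⟨γ₀, h0, fun f => ?_⟩
  have h : ‖((√γ₀ : ℝ) : ℂ) • f‖ ≤ ‖mulSqrt hγ f‖ := by
    refine Lp.norm_le_norm_of_ae_le ?_
    filter_upwards [coeFn_mulSqrt hγ f, Lp.coeFn_smul ((√γ₀ : ℝ) : ℂ) f, hlb] with x h1 h2 h3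
    rw [h1, h2, Pi.smul_apply, smul_eq_mul, norm_mul, norm_mul, Complex.norm_real,
      Complex.norm_real, Real.norm_eq_abs, Real.norm_eq_abs, abs_of_nonneg (Real.sqrt_nonneg _),
      abs_of_nonneg (Real.sqrt_nonneg _)]
    gcongr
  rw [norm_smul, Complex.norm_real, Real.norm_eq_abs, abs_of_nonneg (Real.sqrt_nonneg _)] at h
  calc _ = (√γ₀ * ‖f‖) ^ 2 := by rw [mul_pow, Real.sq_sqrt h0.le]
    _ ≤ _ := pow_le_pow_left₀ (by positivity) h 2

/-- The weighted gradient `u ↦ √γ ∇u`. -/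
noncomputable def weightedGrad (hγ : IsConductivity D γ) :
    H1 D →L[ℂ] PiLp 2 (fun _ : Fin d => L2Domain D) where
  toFun u := WithLp.toLp 2 fun i => mulSqrt hγ (partialDeriv u i)
  map_add' u v := by
    ext1 i
    exact map_add (mulSqrt hγ) (partialDeriv u i) (partialDeriv v i)
  map_smul' c u := by
    ext1 i
    exact map_smul (mulSqrt hγ) c (partialDeriv u i)
  cont := by
    have h := fun i => continuous_partialDeriv (D := D) i
    fun_prop

theorem weightedGrad_apply (hγ : IsConductivity D γ) (u : H1 D) (i : Fin d) :
    weightedGrad hγ u i = mulSqrt hγ (partialDeriv u i) := rfl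

theorem inner_weightedGrad_conjH1 (hγ : IsConductivity D γ) (u v : H1 D) :
    ⟪weightedGrad hγ (conjH1 u), weightedGrad hγ v⟫_ℂ = energyForm γ u v := by
  rw [PiLp.inner_apply, energyForm]
  simp_rw [weightedGrad_apply, partialDeriv_conjH1, (inner_mulSqrt_conjLp hγ _ _).2]
  rw [← integral_finsetSum _ fun i _ => (inner_mulSqrt_conjLp hγ _ _).1]
  simp_rw [Finset.mul_sum]

theorem energyForm_comm (u v : H1 D) : energyForm γ u v = energyForm γ v u := by
  simp only [energyForm, mul_comm (partialDeriv u _ _)]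

theorem norm_weightedGrad_le (hγ : IsConductivity D γ) (u : H1 D) :
    ‖weightedGrad hγ u‖ ≤ √(supNorm D γ) * ‖u‖ := by
  have hs : 0 ≤ supNorm D γ := ENNReal.toReal_nonneg
  rw [← Real.sqrt_sq (norm_nonneg u), ← Real.sqrt_mul hs]
  refine Real.le_sqrt_of_sq_le ?_
  rw [PiLp.norm_sq_eq_of_L2, norm_sq_eq, mul_add, Finset.mul_sum]
  have h : ∑ i, ‖weightedGrad hγ u i‖ ^ 2 ≤ ∑ i, supNorm D γ * ‖partialDeriv u i‖ ^ 2 :=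
    Finset.sum_le_sum fun i _ => norm_mulSqrt_sq_le hγ _
  have : 0 ≤ supNorm D γ * ‖fn u‖ ^ 2 := by positivity
  linarith

/-- The functions of `H¹(D)` with trace zero. -/
noncomputable def traceZero (D : Set (Eu d)) : Submodule ℂ (H1 D) :=
  (traceGraph D).comap (LinearMap.inl ℂ (H1 D) (L2Boundary D))

theorem mem_traceZero {w : H1 D} : w ∈ traceZero D ↔ HasTrace w 0 := Iff.rfl

theorem isClosed_traceZero : IsClosed (traceZero D : Set (H1 D)) := by
  have hc : Continuous fun w : H1 D => (w, (0 : L2Boundary D)) := by fun_prop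
  exact (Submodule.isClosed_topologicalClosure (smoothTracePairs D)).preimage hc

instance : CompleteSpace (traceZero D) := isClosed_traceZero.completeSpace_coe

theorem HasTrace.sub_mem {u v : H1 D} {f : L2Boundary D} (hu : HasTrace u f)
    (hv : HasTrace v f) : u - v ∈ traceZero D := by
  have h : (u, f) - (v, f) ∈ traceGraph D := Submodule.sub_mem _ hu hv
  rw [Prod.mk_sub_mk, sub_self] at h
  exact h

theorem HasTrace.sub_traceZero {u w : H1 D} {f : L2Boundary D} (hu : HasTrace u f)
    (hw : w ∈ traceZero D) : HasTrace (u - w) f := by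
  have h : (u, f) - (w, 0) ∈ traceGraph D := Submodule.sub_mem _ hu hw
  rw [Prod.mk_sub_mk, sub_zero] at h
  exact h

theorem conjH1_mem_traceZero {w : H1 D} (hw : w ∈ traceZero D) : conjH1 w ∈ traceZero D := by
  have h := HasTrace.conj (mem_traceZero.1 hw)
  rwa [map_zero] at h

theorem exists_norm_le_norm_weightedGrad (hd : 2 ≤ d) (hD : IsBoundedLipschitzDomain D)
    (hγ : IsConductivity D γ) :
    ∃ K : ℝ≥0, ∀ w ∈ traceZero D, ‖w‖ ≤ K * ‖weightedGrad hγ w‖ := by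
  obtain ⟨C, hC⟩ := exists_norm_fn_le hd hD
  obtain ⟨c, hc, hlb⟩ := exists_norm_sq_le_norm_mulSqrt_sq hγ
  -- With zero trace, Friedrichs gives `‖w‖² ≤ (C + 1) ‖∇w‖²`, and `c ‖∇w‖² ≤ ‖√γ ∇w‖²`.
  refine ⟨(√((C + 1) / c)).toNNReal, fun w hw => ?_⟩
  rw [Real.coe_toNNReal _ (Real.sqrt_nonneg _), ← Real.sqrt_sq (norm_nonneg (weightedGrad hγ w)),
    ← Real.sqrt_mul (by positivity)]
  refine Real.le_sqrt_of_sq_le ?_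
  have h1 := hC w 0 hw
  have h2 : c * ∑ i, ‖partialDeriv w i‖ ^ 2 ≤ ‖weightedGrad hγ w‖ ^ 2 := by
    rw [PiLp.norm_sq_eq_of_L2, Finset.mul_sum]
    exact Finset.sum_le_sum fun i _ => hlb _
  rw [norm_zero, zero_pow two_ne_zero, zero_add] at h1
  rw [norm_sq_eq, div_mul_eq_mul_div, le_div_iff₀ hc]
  calc (‖fn w‖ ^ 2 + ∑ i, ‖partialDeriv w i‖ ^ 2) * c
      ≤ (C * ∑ i, ‖partialDeriv w i‖ ^ 2 + ∑ i, ‖partialDeriv w i‖ ^ 2) * c := by gcongr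
    _ = (C + 1) * (c * ∑ i, ‖partialDeriv w i‖ ^ 2) := by ring
    _ ≤ _ := by gcongr

/-- Functions of trace zero are stable under conjugation, so the bilinear weak equation is an
orthogonality relation. -/
theorem isDirichletSolution_iff (hγ : IsConductivity D γ) {f : HHalf D} {u : H1 D} :
    IsDirichletSolution γ f u ↔ HasTrace u (f : L2Boundary D) ∧
      ∀ w ∈ traceZero D, ⟪weightedGrad hγ w, weightedGrad hγ u⟫_ℂ = 0 := by
  constructor
  · rintro ⟨h1, h2⟩
    refine ⟨h1, fun w hw => ?_⟩
    have h3 : energyForm γ u (conjH1 w) = 0 := h2 _ (conjH1_mem_traceZero hw)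
    rw [← h3, energyForm_comm, ← inner_weightedGrad_conjH1 hγ, conjH1_conjH1]
  · rintro ⟨h1, h2⟩
    refine ⟨h1, fun w hw => ?_⟩
    rw [energyForm_comm, ← inner_weightedGrad_conjH1 hγ, h2 _ (conjH1_mem_traceZero hw)]

theorem exists_hasTrace (f : HHalf D) : ∃ u : H1 D, HasTrace u (f : L2Boundary D) := by
  obtain ⟨⟨u, g⟩, h, hg⟩ := f.2
  have : g = (f : L2Boundary D) := hg
  exact ⟨u, this ▸ h⟩

theorem existsUnique_isDirichletSolution (hd : 2 ≤ d) (hD : IsBoundedLipschitzDomain D)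
    (hγ : IsConductivity D γ) (f : HHalf D) : ∃! u : H1 D, IsDirichletSolution γ f u := by
  obtain ⟨K, hK⟩ := exists_norm_le_norm_weightedGrad hd hD hγ
  simp_rw [isDirichletSolution_iff hγ]
  obtain ⟨F, hF⟩ := exists_hasTrace f
  set T := (weightedGrad hγ).comp (traceZero D).subtypeL with hT
  have hanti : AntilipschitzWith K T :=
    AddMonoidHomClass.antilipschitz_of_bound T fun w => hK w w.2
  have hcl : IsClosed (T.range : Set (PiLp 2 fun _ : Fin d => L2Domain D)) := by
    exact hanti.isClosed_range T.uniformContinuous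
  have : CompleteSpace T.range := hcl.completeSpace_coe
  obtain ⟨z, hz⟩ : T.range.starProjection (weightedGrad hγ F) ∈ T.range :=
    Submodule.starProjection_apply_mem _ _
  -- `√γ ∇z` is the projection of `√γ ∇F` onto the closed range, so `√γ ∇(F - z)` is orthogonal to
  -- it.
  refine ⟨F - z, ⟨hF.sub_traceZero z.2, fun w hw => ?_⟩, ?_⟩
  · have h := T.range.sub_starProjection_mem_orthogonal (weightedGrad hγ F)
    rw [← hz] at h
    rw [map_sub]
    exact (Submodule.mem_orthogonal _ _).1 h _ ⟨⟨w, hw⟩, rfl⟩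
  -- The difference of two solutions has trace zero, so its weighted gradient is orthogonal to
  -- itself and the lower bound `hK` makes it vanish.
  · rintro u ⟨hu, hu'⟩
    have hw : u - (F - z) ∈ traceZero D := hu.sub_mem (hF.sub_traceZero z.2)
    have h1 := hu' _ hw
    have h2 : ⟪weightedGrad hγ (u - (F - z)), weightedGrad hγ (F - z)⟫_ℂ = 0 := by
      have h := T.range.sub_starProjection_mem_orthogonal (weightedGrad hγ F)
      rw [← hz] at h
      rw [map_sub _ F]
      exact (Submodule.mem_orthogonal _ _).1 h _ ⟨⟨_, hw⟩, rfl⟩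
    have h3 : ⟪weightedGrad hγ (u - (F - z)), weightedGrad hγ (u - (F - z))⟫_ℂ = 0 := by
      rw [map_sub _ u, inner_sub_right, ← map_sub, h1, h2, sub_zero]
    have h4 := hK _ hw
    rw [inner_self_eq_zero.1 h3, norm_zero, mul_zero] at h4
    exact sub_eq_zero.1 (norm_le_zero_iff.1 h4)

/-- Uniqueness makes the choice of solution immaterial, and two extensions of `g` differ by a
function of trace zero, which the weak equation annihilates. -/
theorem dnMap_eq_energyForm (hd : 2 ≤ d) (hD : IsBoundedLipschitzDomain D)
    (hγ : IsConductivity D γ) {f g : HHalf D} {u v : H1 D} (hu : IsDirichletSolution γ f u)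
    (hv : HasTrace v (g : L2Boundary D)) : dnMap γ f g = energyForm γ u v := by
  have h1 : dirichletSolution γ f = u :=
    (existsUnique_isDirichletSolution hd hD hγ f).unique
      (Classical.epsilon_spec (p := IsDirichletSolution γ f) ⟨u, hu⟩) hu
  have h2 : HasTrace (traceExtension g) (g : L2Boundary D) :=
    Classical.epsilon_spec (p := fun v : H1 D => HasTrace v (g : L2Boundary D)) ⟨v, hv⟩
  have h3 : energyForm γ u (traceExtension g - v) = 0 := hu.weak _ (h2.sub_mem hv)
  rw [← inner_weightedGrad_conjH1 hγ, map_sub, inner_sub_right, sub_eq_zero,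
    inner_weightedGrad_conjH1, inner_weightedGrad_conjH1] at h3
  rw [dnMap, h1, h3]

/-- Dirichlet's principle: `F - u` has trace zero, so Pythagoras applies. This keeps the lower bound
of `γ` out of the final constant. -/
theorem norm_weightedGrad_solution_le (hγ : IsConductivity D γ) {f : HHalf D} {u F : H1 D}
    (hu : IsDirichletSolution γ f u) (hF : HasTrace F (f : L2Boundary D)) :
    ‖weightedGrad hγ u‖ ≤ ‖weightedGrad hγ F‖ := by
  have h := ((isDirichletSolution_iff hγ).1 hu).2 _ (hF.sub_mem hu.trace)
  have h1 := norm_add_sq_eq_norm_sq_add_norm_sq_of_inner_eq_zero (weightedGrad hγ (F - u))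
    (weightedGrad hγ u) h
  rw [← map_add, sub_add_cancel] at h1
  refine abs_le_of_sq_le_sq' ?_ (norm_nonneg _) |>.2
  nlinarith [mul_self_nonneg ‖weightedGrad hγ (F - u)‖]

theorem norm_dnMap_le (hd : 2 ≤ d) (hD : IsBoundedLipschitzDomain D)
    (hγ : IsConductivity D γ) {f g : HHalf D} {F G : H1 D} (hF : HasTrace F (f : L2Boundary D))
    (hG : HasTrace G (g : L2Boundary D)) : ‖dnMap γ f g‖ ≤ supNorm D γ * ‖G‖ * ‖F‖ := by
  obtain ⟨u, hu, -⟩ := existsUnique_isDirichletSolution hd hD hγ f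
  rw [dnMap_eq_energyForm hd hD hγ hu hG, energyForm_comm, ← inner_weightedGrad_conjH1 hγ]
  have hs : 0 ≤ supNorm D γ := ENNReal.toReal_nonneg
  calc _ ≤ _ := norm_inner_le_norm _ _
    _ ≤ (√(supNorm D γ) * ‖conjH1 G‖) * (√(supNorm D γ) * ‖F‖) := by
      gcongr
      · exact norm_weightedGrad_le hγ _
      · exact (norm_weightedGrad_solution_le hγ hu hF).trans (norm_weightedGrad_le hγ _)
    _ = (√(supNorm D γ) * √(supNorm D γ)) * ‖G‖ * ‖F‖ := by rw [norm_conjH1]; ring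
    _ = _ := by rw [Real.mul_self_sqrt hs]

theorem hHalfNorm_nonneg (f : HHalf D) : 0 ≤ hHalfNorm f :=
  Real.sInf_nonneg (by rintro _ ⟨u, -, rfl⟩; exact norm_nonneg u)

theorem le_mul_hHalfNorm {f : HHalf D} {x c : ℝ} (hc : 0 ≤ c)
    (h : ∀ u : H1 D, HasTrace u (f : L2Boundary D) → x ≤ c * ‖u‖) : x ≤ c * hHalfNorm f := by
  obtain ⟨u, hu⟩ := exists_hasTrace f
  -- Passing to the infimum divides by `c`; for `c = 0` a single extension suffices.
  rcases hc.eq_or_lt with rfl | hc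
  · simpa using h u hu
  · rw [← div_le_iff₀' hc]
    refine le_csInf ⟨_, u, hu, rfl⟩ ?_
    rintro _ ⟨v, hv, rfl⟩
    exact (div_le_iff₀' hc).2 (h v hv)

theorem norm_dnMap_le_hHalfNorm (hd : 2 ≤ d) (hD : IsBoundedLipschitzDomain D)
    (hγ : IsConductivity D γ) (f g : HHalf D) :
    ‖dnMap γ f g‖ ≤ supNorm D γ * hHalfNorm f * hHalfNorm g := by
  have hs : 0 ≤ supNorm D γ := ENNReal.toReal_nonneg
  refine le_mul_hHalfNorm (mul_nonneg hs (hHalfNorm_nonneg f)) fun G hG => ?_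
  rw [mul_right_comm]
  exact le_mul_hHalfNorm (by positivity) fun F hF => norm_dnMap_le hd hD hγ hF hG

theorem exists_norm_le_hHalfNorm (hD : IsBoundedLipschitzDomain D) :
    ∃ C : ℝ≥0, ∀ f : HHalf D, ‖(f : L2Boundary D)‖ ≤ C * hHalfNorm f := by
  obtain ⟨C, hC⟩ := exists_norm_le_of_hasTrace hD
  refine ⟨NNReal.sqrt C, fun f => le_mul_hHalfNorm (NNReal.coe_nonneg _) fun u hu => ?_⟩
  rw [Real.coe_sqrt, ← Real.sqrt_sq (norm_nonneg u), ← Real.sqrt_mul C.coe_nonneg]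
  exact Real.le_sqrt_of_sq_le (hC u _ hu)

theorem HasTrace.add {u v : H1 D} {f g : L2Boundary D} (hu : HasTrace u f)
    (hv : HasTrace v g) : HasTrace (u + v) (f + g) :=
  Submodule.add_mem _ hu hv

theorem HasTrace.smul {u : H1 D} {f : L2Boundary D} (c : ℂ) (hu : HasTrace u f) :
    HasTrace (c • u) (c • f) :=
  Submodule.smul_mem _ c hu

theorem IsDirichletSolution.add (hγ : IsConductivity D γ) {f f' : HHalf D} {u u' : H1 D}
    (h : IsDirichletSolution γ f u) (h' : IsDirichletSolution γ f' u') :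
    IsDirichletSolution γ (f + f') (u + u') := by
  rw [isDirichletSolution_iff hγ] at *
  refine ⟨h.1.add h'.1, fun w hw => ?_⟩
  rw [map_add, inner_add_right, h.2 w hw, h'.2 w hw, add_zero]

theorem IsDirichletSolution.smul (hγ : IsConductivity D γ) {f : HHalf D} {u : H1 D} (c : ℂ)
    (h : IsDirichletSolution γ f u) : IsDirichletSolution γ (c • f) (c • u) := by
  rw [isDirichletSolution_iff hγ] at *
  refine ⟨h.1.smul c, fun w hw => ?_⟩
  rw [map_smul, inner_smul_right, h.2 w hw, mul_zero]

theorem energyForm_add_right (hγ : IsConductivity D γ) (u v v' : H1 D) :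
    energyForm γ u (v + v') = energyForm γ u v + energyForm γ u v' := by
  simp_rw [← inner_weightedGrad_conjH1 hγ, map_add, inner_add_right]

theorem energyForm_smul_right (hγ : IsConductivity D γ) (c : ℂ) (u v : H1 D) :
    energyForm γ u (c • v) = c * energyForm γ u v := by
  simp_rw [← inner_weightedGrad_conjH1 hγ, map_smul, inner_smul_right]

/-- The form `(f, g) ↦ ∫_∂D Λ_γ f g` as a bilinear map. -/
theorem exists_bilinear_dnMap (hd : 2 ≤ d) (hD : IsBoundedLipschitzDomain D)
    (hγ : IsConductivity D γ) :
    ∃ B : HHalf D →ₗ[ℂ] HHalf D →ₗ[ℂ] ℂ, ∀ f g, B f g = dnMap γ f g := by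
  have hs := fun f => (existsUnique_isDirichletSolution hd hD hγ f).exists
  choose s hs using hs
  have ht := exists_hasTrace (D := D)
  choose t ht using ht
  refine ⟨LinearMap.mk₂ ℂ (dnMap γ) ?_ ?_ ?_ ?_, fun f g => rfl⟩
  · intro f f' g
    -- Sums of solutions are solutions, and symmetry of the energy form moves linearity from its
    -- second argument to its first.
    rw [dnMap_eq_energyForm hd hD hγ ((hs f).add hγ (hs f')) (ht g),
      dnMap_eq_energyForm hd hD hγ (hs f) (ht g), dnMap_eq_energyForm hd hD hγ (hs f') (ht g),
      energyForm_comm, energyForm_add_right hγ, energyForm_comm _ (s f), energyForm_comm _ (s f')]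
  · intro c f g
    rw [dnMap_eq_energyForm hd hD hγ ((hs f).smul hγ c) (ht g),
      dnMap_eq_energyForm hd hD hγ (hs f) (ht g), energyForm_comm, energyForm_smul_right hγ,
      energyForm_comm, smul_eq_mul]
  · intro f g g'
    rw [dnMap_eq_energyForm hd hD hγ (hs f) ((ht g).add (ht g')),
      dnMap_eq_energyForm hd hD hγ (hs f) (ht g), dnMap_eq_energyForm hd hD hγ (hs f) (ht g'),
      energyForm_add_right hγ]
  · intro c f g
    rw [dnMap_eq_energyForm hd hD hγ (hs f) ((ht g).smul c),
      dnMap_eq_energyForm hd hD hγ (hs f) (ht g), energyForm_smul_right hγ, smul_eq_mul]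

end Dirichlet

end Calderon

namespace Calderon

/-! ### The noisy data: bilinearity, second moment and almost sure values -/

section NoisyData

variable {d : ℕ} {D : Set (Eu d)} {γ : Eu d → ℝ} {Ω : Type*} [MeasurableSpace Ω]
  {P : Measure Ω} {X : ℕ × ℕ → Ω → ℂ}

theorem exists_bilinear_noise (e : HilbertBasis ℕ ℂ (L2Boundary D)) (hX : IsNoise P X) :
    ∃ B : HHalf D →ₗ[ℂ] HHalf D →ₗ[ℂ] Lp ℂ 2 P, ∀ f g, B f g = ∑' α, noiseTerm e hX f g α := by
  have hs := fun f g => summable_noiseTerm e hX f g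
  refine ⟨LinearMap.mk₂ ℂ (fun f g => ∑' α, noiseTerm e hX f g α) ?_ ?_ ?_ ?_, fun f g => rfl⟩
  · intro f f' g
    rw [← (hs f g).tsum_add (hs f' g)]
    refine tsum_congr fun α => ?_
    simp only [noiseTerm, noiseCoeff, Submodule.coe_add, inner_add_right, add_mul, add_smul]
  · intro c f g
    rw [← (hs f g).tsum_const_smul c]
    refine tsum_congr fun α => ?_
    simp only [noiseTerm, noiseCoeff, Submodule.coe_smul, inner_smul_right, smul_smul, mul_assoc]
  · intro f g g'
    rw [← (hs f g).tsum_add (hs f g')]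
    refine tsum_congr fun α => ?_
    simp only [noiseTerm, noiseCoeff, Submodule.coe_add, inner_add_right, mul_add, add_smul]
  · intro c f g
    rw [← (hs f g).tsum_const_smul c]
    refine tsum_congr fun α => ?_
    simp only [noiseTerm, noiseCoeff, Submodule.coe_smul, inner_smul_right, smul_smul,
      mul_left_comm]

theorem integral_norm_sq_eq (f : Lp ℂ 2 P) : ∫ ω, ‖f ω‖ ^ 2 ∂P = ‖f‖ ^ 2 := by
  have h := inner_self_eq_norm_sq (𝕜 := ℂ) f
  rw [← h, L2.inner_def, ← integral_re (L2.integrable_inner f f)]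
  exact integral_congr_ae (Eventually.of_forall fun ω => (inner_self_eq_norm_sq (𝕜 := ℂ) _).symm)

variable [IsProbabilityMeasure P]

theorem exists_bilinear_noisyData (hd : 2 ≤ d) (hD : IsBoundedLipschitzDomain D)
    (hγ : IsConductivity D γ) (e : HilbertBasis ℕ ℂ (L2Boundary D)) (hX : IsNoise P X) :
    ∃ B : HHalf D →ₗ[ℂ] HHalf D →ₗ[ℂ] Lp ℂ 2 P, ∀ f g, B f g = noisyData γ e hX f g := by
  obtain ⟨B₁, h1⟩ := exists_bilinear_dnMap hd hD hγ
  obtain ⟨B₂, h2⟩ := exists_bilinear_noise e hX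
  refine ⟨B₁.compr₂ (Lp.constₗ 2 P ℂ) + B₂, fun f g => ?_⟩
  simp [h1, h2, noisyData]

theorem integral_norm_noisyData_sq_le (hd : 2 ≤ d) (hD : IsBoundedLipschitzDomain D)
    {C : ℝ} (hC : ∀ f : HHalf D, ‖(f : L2Boundary D)‖ ≤ C * hHalfNorm f)
    (hγ : IsConductivity D γ) (e : HilbertBasis ℕ ℂ (L2Boundary D)) (hX : IsNoise P X)
    (f g : HHalf D) : ∫ ω, ‖noisyData γ e hX f g ω‖ ^ 2 ∂P ≤
      (2 + 2 * C ^ 4) * (1 + supNorm D γ ^ 2) * hHalfNorm f ^ 2 * hHalfNorm g ^ 2 := by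
  rw [integral_norm_sq_eq]
  set a := hHalfNorm f
  set b := hHalfNorm g
  set s := supNorm D γ
  have h1 : ‖noisyData γ e hX f g‖ ≤ ‖dnMap γ f g‖ + ‖∑' α, noiseTerm e hX f g α‖ := by
    refine (norm_add_le _ _).trans (add_le_add ?_ le_rfl)
    refine (Lp.norm_const_le _ _ _).trans ?_
    simp
  have h2 : ‖dnMap γ f g‖ ^ 2 ≤ (s * a * b) ^ 2 :=
    pow_le_pow_left₀ (norm_nonneg _) (norm_dnMap_le_hHalfNorm hd hD hγ f g) 2
  have h3 : ‖∑' α, noiseTerm e hX f g α‖ ^ 2 ≤ (C * a) ^ 2 * (C * b) ^ 2 := by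
    rw [norm_tsum_noiseTerm_sq]
    gcongr
    · exact hC f
    · exact hC g
  have h4 : 0 ≤ a ^ 2 * b ^ 2 := by positivity
  calc ‖noisyData γ e hX f g‖ ^ 2
      ≤ (‖dnMap γ f g‖ + ‖∑' α, noiseTerm e hX f g α‖) ^ 2 :=
        pow_le_pow_left₀ (norm_nonneg _) h1 2
    _ ≤ 2 * (‖dnMap γ f g‖ ^ 2 + ‖∑' α, noiseTerm e hX f g α‖ ^ 2) := add_sq_le
    _ ≤ 2 * ((s * a * b) ^ 2 + (C * a) ^ 2 * (C * b) ^ 2) := by gcongr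
    _ = (2 * s ^ 2 + 2 * C ^ 4) * (a ^ 2 * b ^ 2) := by ring
    -- The right side exceeds the left by `(2 + 2 C⁴ s²) a² b²`.
    _ ≤ (2 + 2 * C ^ 4) * (1 + s ^ 2) * (a ^ 2 * b ^ 2) := by
      gcongr
      have : 0 ≤ C ^ 4 * s ^ 2 := by positivity
      nlinarith
    _ = _ := by ring

theorem ae_tendsto_noisyData (e : HilbertBasis ℕ ℂ (L2Boundary D)) (hX : IsNoise P X)
    (f g : HHalf D) (κ : ℕ ≃ ℕ × ℕ) : ∀ᵐ ω ∂P,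
      Tendsto (fun n : ℕ => dnMap γ f g +
        ∑ k ∈ Finset.range n, noiseCoeff e f g (κ k) * X (κ k) ω)
        atTop (𝓝 (noisyData γ e hX f g ω)) := by
  filter_upwards [ae_tendsto_sum_noise e hX f g κ,
    Lp.coeFn_add (Lp.const 2 P (dnMap γ f g)) (∑' α, noiseTerm e hX f g α),
    Lp.coeFn_const (p := 2) (μ := P) (c := dnMap γ f g)] with ω h1 h2 h3
  rw [noisyData, h2, Pi.add_apply, h3]
  exact h1.const_add _

end NoisyData

end Calderon


theorem mainTheorem6 (d : ℕ) (hd : 2 ≤ d) (D : Set (Calderon.Eu d))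
    (hD : Calderon.IsBoundedLipschitzDomain D) :
    ∃ C : ℝ, 0 < C ∧
      ∀ γ : Calderon.Eu d → ℝ, Calderon.IsConductivity D γ →
        -- the Dirichlet-to-Neumann map is well defined
        (∀ f : Calderon.HHalf D, ∃! u : Calderon.H1 D, Calderon.IsDirichletSolution γ f u) ∧
        (∀ (f g : Calderon.HHalf D) (u v : Calderon.H1 D), Calderon.IsDirichletSolution γ f u →
          Calderon.HasTrace v (g : Calderon.L2Boundary D) →
          Calderon.dnMap γ f g = Calderon.energyForm γ u v) ∧
        ∀ (Ω : Type*) [MeasurableSpace Ω] (P : Measure Ω) [IsProbabilityMeasure P]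
          (e : HilbertBasis ℕ ℂ (Calderon.L2Boundary D)) (X : ℕ × ℕ → Ω → ℂ)
          (hX : Calderon.IsNoise P X),
          -- the series in the definition of the noisy data converges in `L²(Ω)`
          (∀ f g : Calderon.HHalf D, Summable (Calderon.noiseTerm e hX f g)) ∧
          -- the noisy data is bilinear
          (∃ B : Calderon.HHalf D →ₗ[ℂ] Calderon.HHalf D →ₗ[ℂ] Lp ℂ 2 P,
            ∀ f g : Calderon.HHalf D, B f g = Calderon.noisyData γ e hX f g) ∧
          -- and bounded
          (∀ f g : Calderon.HHalf D,
            ∫ ω, ‖Calderon.noisyData γ e hX f g ω‖ ^ 2 ∂P ≤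
              C * (1 + Calderon.supNorm D γ ^ 2) *
                Calderon.hHalfNorm f ^ 2 * Calderon.hHalfNorm g ^ 2) ∧
          -- almost surely finite: the partial sums converge almost surely to a complex number,
          -- the value of the noisy data
          (∀ (f g : Calderon.HHalf D) (κ : ℕ ≃ ℕ × ℕ), ∀ᵐ ω ∂P,
            Tendsto (fun n : ℕ => Calderon.dnMap γ f g +
                ∑ k ∈ Finset.range n, Calderon.noiseCoeff e f g (κ k) * X (κ k) ω)
              atTop (𝓝 (Calderon.noisyData γ e hX f g ω))) := by
  obtain ⟨K, hK⟩ := Calderon.exists_norm_le_hHalfNorm hD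
  -- Only the trace constant `K` enters, and it is fixed before `γ`, the probability space and the
  -- basis.
  refine ⟨2 + 2 * (K : ℝ) ^ 4, by positivity, fun γ hγ =>
    ⟨Calderon.existsUnique_isDirichletSolution hd hD hγ,
      fun f g u v hu hv => Calderon.dnMap_eq_energyForm hd hD hγ hu hv, ?_⟩⟩
  intro Ω _ P _ e X hX
  exact ⟨Calderon.summable_noiseTerm e hX, Calderon.exists_bilinear_noisyData hd hD hγ e hX,
    Calderon.integral_norm_noisyData_sq_le hd hD hK hγ e hX,
    Calderon.ae_tendsto_noisyData e hX⟩
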